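/- **Setting.** For $n,k\ge 1$ let $\mathrm{Disj}_{n,k}(X^1,\dots,X^k)=\bigvee_{j=1}^n\bigwedge_{i=1}^k X^i_j$ for $X^1,\dots,X^k\in\{0,1\}^n$. Consider randomized private-coin protocols in the coordinator model: each of $k$ players holds an input $X^i$, the coordinator holds none, and all participants have independent private coins. In each round the coordinator, depending on its coins and on all messages so far, either stops and outputs an answer, or sends a message (a bit string) to one player $i$, who replies with a message that depends on its coins, its input $X^i$, and the messages so far on the channel between it and the coordinator. The number of rounds is bounded and the coins range over a finite set. $\Pi^i(X)$ denotes the sequence of messages, in both directions, between player $i$ and the coordinator when $\Pi$ is run on $X$. A protocol solves a problem with error at most $\delta$ if on every input the coordinator's answer is wrong with probability at most $\delta$. For a joint distribution $\eta$ of $(\mathbf X,\mathbf M,\mathbf Z)$ the switched information cost of $\Pi$ is $$\mathrm{SIC}_\eta(\Pi)=\sum_{i=1}^k\Big[I\big(\mathbf X^i;\Pi^i(\mathbf X)\mid \mathbf M,\mathbf Z\big)+I\big(\mathbf M;\Pi^i(\mathbf X)\mid \mathbf X^i,\mathbf Z\big)\Big],$$ where the protocol's coins are independent of $(\mathbf X,\mathbf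 M,\mathbf Z)\sim\eta$, and $\mathrm{SIC}_{\eta,\delta}(\mathcal P)$ is the infimum of $\mathrm{SIC}_\eta(\Pi)$ over all protocols $\Pi$ that solve $\mathcal P$ with error at most $\delta$. Let $\xi$ be the following distribution of $(\mathbf X,\mathbf M,\mathbf Z)\in\{0,1\}^k\times\{0,1\}\times[k]$: $\mathbf Z$ is uniform on $[k]$; independently, $\Pr[\mathbf M=0]=2/3$ and $\Pr[\mathbf M=1]=1/3$; if $\mathbf M=0$, then $\mathbf X$ is uniform on $\{0,1\}^k$; if $\mathbf M=1$, then $\mathbf X$ is the vector with $0$ in position $\mathbf Z$ and $1$ elsewhere. Let $\eta=\xi^n$ be the distribution of $(\mathbf X,\mathbf M,\mathbf Z)$ for which the $n$ triples $(\mathbf X_j,\mathbf M_j,\mathbf Z_j)$, $j\in[n]$, with $\mathbf X_j=(\mathbf X^1_j,\dots,\mathbf X^k_j)$, are independent samples from $\xi$. **Theorem.** For every $0\le\delta<1/2$ there are constants $C,c>0$, depending only on $\delta$, such that for all $n\ge 1$ and all $k\ge 1$ with $k\ge C\log_2 n$, $$\mathrm{SIC}_{\eta,\delta}(\mathrm{Disj}_{n,k})\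 \ge\ c\,n\,k .$$ -/

import Mathlib

namespace SetDisjointness

noncomputable section

/-! ### Finite probability spaces and information (in bits) -/

/-- Probability distributions on a finite set. -/
abbrev Dist (Ω : Type*) [Fintype Ω] := stdSimplex ℝ Ω

/-- The product of two distributions. -/
def Dist.prod {α β : Type*} [Fintype α] [Fintype β] (p : Dist α) (q : Dist β) : Dist (α × β) :=
  ⟨fun ω => p ω.1 * q ω.2, fun ω => mul_nonneg (p.2.1 ω.1) (q.2.1 ω.2), by
    rw [Fintype.sum_prod_type]
    simp_rw [← Finset.mul_sum]
    have hp : ∑ a, p a = 1 := p.2.2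
    have hq : ∑ b, q b = 1 := q.2.2
    simp [hq, hp]⟩

/-- The product of a finite family of distributions: independent coordinates. -/
def Dist.pi {ι α : Type*} [Fintype ι] [DecidableEq ι] [Fintype α] (p : ι → Dist α) :
    Dist (ι → α) :=
  ⟨fun ω => ∏ i, p i (ω i), fun ω => Finset.prod_nonneg fun i _ => (p i).2.1 (ω i), by
    have h : ∀ i, ∑ a, p i a = 1 := fun i => (p i).2.2
    rw [← Fintype.piFinset_univ, ← Finset.prod_univ_sum]
    simp [h]⟩

section Information

variable {Ω α β γ : Type*} [Fintype Ω]

/-- The probability of an event. -/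
def prob (μ : Dist Ω) (E : Set Ω) : ℝ := ∑ ω, E.indicator (fun ω => μ ω) ω

/-- The conditional probability `Pr[E | F]`. -/
def condProb (μ : Dist Ω) (E F : Set Ω) : ℝ := prob μ (E ∩ F) / prob μ F

open Classical in
/-- `H(A | F)`: the entropy, in bits, of the distribution of the random variable `A` conditioned
on the event `F`. -/
def entropyOn (μ : Dist Ω) (A : Ω → α) (F : Set Ω) : ℝ :=
  ∑ a ∈ Finset.univ.image A,
    condProb μ {ω | A ω = a} F * Real.logb 2 (1 / condProb μ {ω | A ω = a} F)

open Classical in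
/-- The conditional entropy `H(A | B) = ∑ b, Pr[B = b] * H(A | B = b)`. -/
def condEntropy (μ : Dist Ω) (A : Ω → α) (B : Ω → β) : ℝ :=
  ∑ b ∈ Finset.univ.image B, prob μ {ω | B ω = b} * entropyOn μ A {ω | B ω = b}

/-- The conditional mutual information `I(A ; B | C) = H(A | C) - H(A | B, C)`. -/
def condMutualInfo (μ : Dist Ω) (A : Ω → α) (B : Ω → β) (C : Ω → γ) : ℝ :=
  condEntropy μ A C - condEntropy μ A (fun ω => (B ω, C ω))

end Information

/-! ### Private-coin protocols in the coordinator model -/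

/-- A message is a bit string. Transcripts are lists of messages, so every participant sees where
a message ends. -/
abbrev Message := List Bool

/-- One round: the coordinator sends `query` to `player`, and this player answers `reply`. -/
structure Exchange (k : ℕ) where
  player : Fin k
  query : Message
  reply : Message

/-- The part of a transcript that player `i` sees: the messages, in both directions, on the channel
between player `i` and the coordinator. -/
def channel {k : ℕ} (i : Fin k) (τ : List (Exchange k)) : List (Message × Message) :=
  (τ.filter (fun e => decide (e.player = i))).map (fun e => (e.query, e.reply))

/-- A private-coin protocol in the coordinator model with `k` players, each holding an input
in `I`. The coordinator has no input. The numbers of rounds and of coin outcomes are finite, but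
may be arbitrarily large. -/
structure Protocol (k : ℕ) (I : Type) where
  /-- the sample space from which the participants' private coins are drawn -/
  Coin : Type
  [fintypeCoin : Fintype Coin]
  /-- the law of the coordinator's private coins -/
  coordinatorLaw : Dist Coin
  /-- the laws of the players' private coins -/
  playerLaw : Fin k → Dist Coin
  /-- an upper bound for the number of rounds -/
  rounds : ℕ
  /-- From its coins and the transcript so far, the coordinator decides to stop (`none`), or to send
  a message to one of the players. -/
  coordinator : Coin → List (Exchange k) → Option (Fin k × Message)
  /-- Player `i` answers a message of the coordinator according to its own coins, its own input and
  the earlier messages on its own channel. -/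
  player : Fin k → Coin → I → List (Message × Message) → Message → Message
  /-- the answer that the coordinator gives at the end -/
  output : Coin → List (Exchange k) → Bool

namespace Protocol

variable {k : ℕ} {I : Type}

attribute [instance] Protocol.fintypeCoin

/-- The outcomes of all private coins: the coordinator's, and each player's. -/
abbrev Coins (P : Protocol k I) : Type := P.Coin × (Fin k → P.Coin)

/-- All the private coins are independent. -/
def coinLaw (P : Protocol k I) : Dist P.Coins :=
  Dist.prod P.coordinatorLaw (Dist.pi P.playerLaw)

/-- The transcript after at most `t` rounds, on input `X` and with coin outcomes `r`. -/
def run (P : Protocol k I) (X : Fin k → I) (r : P.Coins) : ℕ → List (Exchange k)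
  | 0 => []
  | t + 1 =>
    let τ := P.run X r t
    match P.coordinator r.1 τ with
    | none => τ
    | some (i, q) => τ ++ [⟨i, q, P.player i (r.2 i) (X i) (channel i τ) q⟩]

/-- The complete transcript, as seen by the coordinator. -/
def transcript (P : Protocol k I) (X : Fin k → I) (r : P.Coins) : List (Exchange k) :=
  P.run X r P.rounds

/-- Player `i`'s view of the complete transcript. -/
def view (P : Protocol k I) (i : Fin k) (X : Fin k → I) (r : P.Coins) :
    List (Message × Message) :=
  channel i (P.transcript X r)

/-- The answer of the coordinator. -/
def answer (P : Protocol k I) (X : Fin k → I) (r : P.Coins) : Bool :=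
  P.output r.1 (P.transcript X r)

/-- `P` solves the problem `f` with error at most `δ`: on every input, the probability of an
incorrect answer, over the private coins, is at most `δ`. -/
def HasError (P : Protocol k I) (f : (Fin k → I) → Bool) (δ : ℝ) : Prop :=
  ∀ X : Fin k → I, prob P.coinLaw {r | P.answer X r ≠ f X} ≤ δ

/-- The switched information cost of `P` with respect to a distribution `η` of `(X, M, Z)`:
the sum over all players `i` of `I(X^i ; Π^i(X) | M, Z) + I(M ; Π^i(X) | X^i, Z)`. A point
`((X, M, Z), r)` of the sample space consists of a sample from `η` and the independent coins. -/
def switchedInfoCost {𝓜 𝓩 : Type} [Fintype I] [Fintype 𝓜] [Fintype 𝓩]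
    (η : Dist ((Fin k → I) × 𝓜 × 𝓩)) (P : Protocol k I) : ℝ :=
  ∑ i : Fin k,
    (condMutualInfo (Dist.prod η P.coinLaw)
        (fun ω => ω.1.1 i) (fun ω => P.view i ω.1.1 ω.2) (fun ω => (ω.1.2.1, ω.1.2.2))
      + condMutualInfo (Dist.prod η P.coinLaw)
        (fun ω => ω.1.2.1) (fun ω => P.view i ω.1.1 ω.2) (fun ω => (ω.1.1 i, ω.1.2.2)))

end Protocol

/-- The switched information cost of a problem `f` with error `δ`: the infimum of the switched
information costs of the protocols that solve `f` with error at most `δ`. -/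
def switchedInfoComplexity {k : ℕ} {I 𝓜 𝓩 : Type} [Fintype I] [Fintype 𝓜] [Fintype 𝓩]
    (η : Dist ((Fin k → I) × 𝓜 × 𝓩)) (δ : ℝ) (f : (Fin k → I) → Bool) : EReal :=
  ⨅ (P : Protocol k I) (_ : P.HasError f δ), (P.switchedInfoCost η : EReal)

/-! ### Set Disjointness and its hard distribution -/

/-- `Disj_{n,k}(X^1, …, X^k) = ⋁ j, ⋀ i, X^i_j`. -/
def disj (n k : ℕ) (X : Fin k → (Fin n → Bool)) : Bool :=
  decide (∃ j : Fin n, ∀ i : Fin k, X i j = true)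

/-- The input in which player `z` receives zero, and all other players receive one. -/
def eBar {k : ℕ} (z : Fin k) : Fin k → Bool := fun i => decide (i ≠ z)

/-- The probability of `(X, M, Z)` under the one-coordinate distribution: `Z` is uniform,
`M = 0` (`false`) and `M = 1` (`true`) have probabilities `2/3` and `1/3` independently of `Z`,
given `M = 0` the vector `X` is uniform, and given `M = 1` it is `eBar Z`. -/
def xiMass {k : ℕ} (x : Fin k → Bool) (m : Bool) (z : Fin k) : ℝ :=
  (1 / k) * (if m then (1 / 3) * (if x = eBar z then 1 else 0) else (2 / 3) * (1 / 2) ^ k)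

theorem xiMass_nonneg {k : ℕ} (x : Fin k → Bool) (m : Bool) (z : Fin k) : 0 ≤ xiMass x m z := by
  unfold xiMass
  split_ifs <;> positivity

theorem sum_xiMass (k : ℕ) [NeZero k] :
    ∑ t : (Fin k → Bool) × Bool × Fin k, xiMass t.1 t.2.1 t.2.2 = 1 := by
  have hk : (k : ℝ) ≠ 0 := Nat.cast_ne_zero.mpr (NeZero.ne k)
  rw [Fintype.sum_prod_type_right, Fintype.sum_prod_type]
  have h2 : (2 : ℝ) ^ k ≠ 0 := by positivity
  simp only [xiMass, Fintype.sum_bool, ← Finset.mul_sum]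
  simp
  field_simp
  norm_num

/-- The hard distribution `ξ` of `(X, M, Z)` for a single coordinate. -/
def xi (k : ℕ) [NeZero k] : Dist ((Fin k → Bool) × Bool × Fin k) :=
  ⟨fun t => xiMass t.1 t.2.1 t.2.2, fun t => xiMass_nonneg t.1 t.2.1 t.2.2, sum_xiMass k⟩

/-- A family, indexed by the coordinates `j`, of triples `(X_j, M_j, Z_j)` is the same as a triple
of a `k`-tuple `X` of inputs, and vectors `M` and `Z`. -/
def regroup (n k : ℕ) : (Fin n → (Fin k → Bool) × Bool × Fin k) ≃
    (Fin k → (Fin n → Bool)) × (Fin n → Bool) × (Fin n → Fin k) where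
  toFun t := (fun i j => (t j).1 i, fun j => (t j).2.1, fun j => (t j).2.2)
  invFun s := fun j => (fun i => s.1 i j, s.2.1 j, s.2.2 j)
  left_inv _ := rfl
  right_inv _ := rfl

/-- The distribution `η = ξ^n`: the triples `(X_j, M_j, Z_j)` are independent samples
from `ξ`. -/
def eta (n k : ℕ) [NeZero k] :
    Dist ((Fin k → (Fin n → Bool)) × (Fin n → Bool) × (Fin n → Fin k)) :=
  ⟨fun s => ∏ j, xi k (fun i => s.1 i j, s.2.1 j, s.2.2 j),
    fun s => (Dist.pi fun _ : Fin n => xi k).2.1 ((regroup n k).symm s), by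
      have h := (Dist.pi fun _ : Fin n => xi k).2.2
      rw [← (regroup n k).symm.sum_comp] at h
      exact h⟩

end

end SetDisjointness

/-! Relative entropy dominates squared Hellinger distance h², so the information a message reveals
about a balanced bit is at least half the h² between the two (sub-normalized) laws of the message
(`hellinger_le_cmi_of_balanced`). The weights 2/3 and 1/3 in ξ balance two bits: X^i given M = 0,
and M given X^i = 1 and Z = z ≠ i. The two terms of the cost therefore force apart, or keep close,
the laws of player i's view (a) on uniform inputs with own bit 0 versus 1, and (b) on uniform inputs
with own bit 1 versus the input `eBar z`.

If (a) and (b) are small for players i and z, the rectangle property (`Protocol.run_eq_iff`,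
`law_record`) transfers closeness to complete transcripts. Cut-and-paste on the view
(`sqHellinger_cut_paste`) shows that setting bit i of `eBar z` to 0 hardly changes player i's view,
hence hardly changes the transcript (`sqHellinger_full_update`). So `eBar i` and `eBar z` are both
close to the input y with zeros at i and z. Cut-and-paste for transcripts gives h²(1, y) = h²(`eBar
i`, `eBar z`), so all-ones is close to `eBar z`. A correct protocol must separate these two inputs;
averaging over pairs i ≠ z gives a cost of order k for one coordinate
(`RectangularFamily.le_sum_sqHellinger`).

For n coordinates, the chain rule is applied in increasing order to X^i and in decreasing order to
M. By independence of the coordinates, M below j may be dropped from the first conditioning and X^i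
above j from the second. Both terms then have the same context: X^i below j, M above j, and Z
(`sum_cmi_input_le`, `sum_cmi_aux_le`). Coordinate j thus sees a single one-bit protocol, in which
the samples below j and (M, Z) above j are public, and each player draws its bits above j privately.

This protocol separates all-ones from `eBar z`: another coordinate is all-ones with probability
below 2^(-k), so the acceptance gap is at least 1 - 2δ - (n-1)2^(-k), which k ≥ C log n keeps
bounded away from 0. -/

namespace SetDisjointness

noncomputable section

/-! ### Entropy and mutual information in nats, with Hellinger lower bounds -/

section Entropy

variable {Ω α β γ δ : Type*} [Fintype Ω]

/-- The law of a random variable. -/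
def law (μ : Dist Ω) (A : Ω → α) (a : α) : ℝ := prob μ {ω | A ω = a}

open Classical in
theorem prob_setOf (μ : Dist Ω) (p : Ω → Prop) :
    prob μ {ω | p ω} = ∑ ω, if p ω then μ ω else 0 := by
  simp [prob, Set.indicator_apply]

theorem prob_nonneg (μ : Dist Ω) (E : Set Ω) : 0 ≤ prob μ E :=
  Finset.sum_nonneg fun ω _ => Set.indicator_nonneg (fun ω _ => μ.2.1 ω) ω

theorem prob_mono (μ : Dist Ω) {E F : Set Ω} (h : E ⊆ F) : prob μ E ≤ prob μ F :=
  Finset.sum_le_sum fun _ _ => Set.indicator_le_indicator_of_subset h (fun ω => μ.2.1 ω) _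

theorem law_nonneg (μ : Dist Ω) (A : Ω → α) (a : α) : 0 ≤ law μ A a := prob_nonneg _ _

theorem le_law_self (μ : Dist Ω) (A : Ω → α) (ω : Ω) : μ ω ≤ law μ A (A ω) := by
  classical
  unfold law
  rw [prob_setOf]
  have h := Finset.single_le_sum (f := fun ω' => if A ω' = A ω then μ ω' else 0)
    (fun ω' _ => by split_ifs <;> [exact μ.2.1 ω'; exact le_rfl]) (Finset.mem_univ ω)
  simpa using h

theorem law_self_pos {μ : Dist Ω} (A : Ω → α) {ω : Ω} (h : μ ω ≠ 0) : 0 < law μ A (A ω) :=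
  ((μ.2.1 ω).lt_of_ne' h).trans_le (le_law_self μ A ω)

theorem sum_mul_comp_of_mem (μ : Dist Ω) (A : Ω → α) (f : α → ℝ) (s : Finset α)
    (hs : ∀ ω, A ω ∈ s) : ∑ ω, μ ω * f (A ω) = ∑ a ∈ s, law μ A a * f a := by
  classical
  simp_rw [law, prob_setOf, Finset.sum_mul]
  rw [Finset.sum_comm]
  refine Finset.sum_congr rfl fun ω _ => ?_
  simp [hs]

theorem sum_mul_comp [Fintype α] (μ : Dist Ω) (A : Ω → α) (f : α → ℝ) :
    ∑ ω, μ ω * f (A ω) = ∑ a, law μ A a * f a :=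
  sum_mul_comp_of_mem μ A f _ fun _ => Finset.mem_univ _

theorem sum_law [Fintype α] (μ : Dist Ω) (A : Ω → α) : ∑ a, law μ A a = 1 := by
  have h := sum_mul_comp μ A fun _ => 1
  simp only [mul_one] at h
  rw [← h]
  exact μ.2.2

open Classical in
theorem law_comp [Fintype α] (μ : Dist Ω) (A : Ω → α) (f : α → β) (b : β) :
    law μ (fun ω => f (A ω)) b = ∑ a, if f a = b then law μ A a else 0 := by
  have h := sum_mul_comp μ A fun a => if f a = b then 1 else 0
  simp only [mul_ite, mul_one, mul_zero] at h
  rw [← h, law, prob_setOf]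

theorem law_congr (μ : Dist Ω) {A : Ω → α} {B : Ω → β}
    (h : ∀ ω ω', A ω = A ω' ↔ B ω = B ω') (ω : Ω) :
    law μ A (A ω) = law μ B (B ω) := by
  simp only [law, h]

/-- The entropy, in nats, of a random variable. -/
def ent (μ : Dist Ω) (A : Ω → α) : ℝ := -∑ ω, μ ω * Real.log (law μ A (A ω))

/-- Entropy sees only the partition of the sample space induced by a variable. Variables can
therefore be recoded freely; in particular list-valued views can be given a finite type. -/
theorem ent_congr (μ : Dist Ω) {A : Ω → α} {B : Ω → β}
    (h : ∀ ω ω', A ω = A ω' ↔ B ω = B ω') : ent μ A = ent μ B := by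
  simp only [ent, law_congr μ h]

theorem condEntropy_eq (μ : Dist Ω) (A : Ω → α) (B : Ω → β) :
    condEntropy μ A B = (ent μ (fun ω => (A ω, B ω)) - ent μ B) / Real.log 2 := by
  classical
  have h := sum_mul_comp_of_mem μ (fun ω => (A ω, B ω))
    (fun x => Real.log (law μ B x.2) - Real.log (law μ (fun ω => (A ω, B ω)) x))
    (Finset.univ.image A ×ˢ Finset.univ.image B) (fun ω => by simp)
  have h1 : ent μ (fun ω => (A ω, B ω)) - ent μ B =
      ∑ ω, μ ω * (Real.log (law μ B (B ω)) -
        Real.log (law μ (fun ω => (A ω, B ω)) (A ω, B ω))) := by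
    simp only [ent, mul_sub, Finset.sum_sub_distrib]
    ring
  rw [h1, h, Finset.sum_product_right, Finset.sum_div, condEntropy]
  refine Finset.sum_congr (by congr!) fun b _ => ?_
  rw [entropyOn, Finset.mul_sum, Finset.sum_div]
  refine Finset.sum_congr (by congr!) fun a _ => ?_
  have hab : prob μ ({ω | A ω = a} ∩ {ω | B ω = b}) = law μ (fun ω => (A ω, B ω)) (a, b) := by
    unfold law
    congr 1
    ext ω
    simp
  rw [condProb, hab]
  have hle : law μ (fun ω => (A ω, B ω)) (a, b) ≤ law μ B b :=
    prob_mono μ fun ω hω => (Prod.ext_iff.mp hω).2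
  change law μ B b * _ = _
  -- A null pair contributes 0 on both sides, whatever the conventions for division by zero and the
  -- logarithm of zero.
  rcases (law_nonneg μ (fun ω => (A ω, B ω)) (a, b)).eq_or_lt with h0 | h0
  · change _ = law μ (fun ω => (A ω, B ω)) (a, b) * _ / _
    rw [← h0]
    simp
  · have hb := h0.trans_le hle
    change law μ B b * (_ / law μ B b * Real.logb 2 (1 / (_ / law μ B b))) = _
    rw [one_div_div, Real.logb, Real.log_div hb.ne' h0.ne']
    have h2 : Real.log 2 ≠ 0 := (Real.log_pos one_lt_two).ne'
    field_simp

/-- The conditional mutual information `I(A ; B | C)` in nats. -/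
def cmi (μ : Dist Ω) (A : Ω → α) (B : Ω → β) (C : Ω → γ) : ℝ :=
  ent μ (fun ω => (A ω, C ω)) + ent μ (fun ω => (B ω, C ω)) - ent μ C
    - ent μ (fun ω => (A ω, B ω, C ω))

theorem condMutualInfo_eq (μ : Dist Ω) (A : Ω → α) (B : Ω → β) (C : Ω → γ) :
    condMutualInfo μ A B C = cmi μ A B C / Real.log 2 := by
  rw [condMutualInfo, condEntropy_eq, condEntropy_eq, cmi]
  ring

theorem cmi_congr (μ : Dist Ω) {α' β' γ' : Type*} {A : Ω → α} {B : Ω → β} {C : Ω → γ}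
    {A' : Ω → α'} {B' : Ω → β'} {C' : Ω → γ'}
    (hA : ∀ ω ω', A ω = A ω' ↔ A' ω = A' ω') (hB : ∀ ω ω', B ω = B ω' ↔ B' ω = B' ω')
    (hC : ∀ ω ω', C ω = C ω' ↔ C' ω = C' ω') : cmi μ A B C = cmi μ A' B' C' := by
  unfold cmi
  rw [ent_congr μ hC]
  congr 1
  · congr 2 <;> apply ent_congr <;> intro ω ω' <;> simp only [Prod.mk.injEq, *]
  · apply ent_congr
    intro ω ω'
    simp only [Prod.mk.injEq, *]

theorem cmi_eq_sum (μ : Dist Ω) (A : Ω → α) (B : Ω → β) (C : Ω → γ) :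
    cmi μ A B C = ∑ ω, μ ω * (Real.log (law μ (fun ω => (A ω, B ω, C ω)) (A ω, B ω, C ω))
      + Real.log (law μ C (C ω)) - Real.log (law μ (fun ω => (A ω, C ω)) (A ω, C ω))
      - Real.log (law μ (fun ω => (B ω, C ω)) (B ω, C ω))) := by
  simp only [cmi, ent, mul_sub, mul_add, Finset.sum_sub_distrib, Finset.sum_add_distrib]
  ring

theorem cmi_eq_zero (μ : Dist Ω) (A : Ω → α) (B : Ω → β) (C : Ω → γ)
    (h : ∀ ω, law μ (fun ω => (A ω, B ω, C ω)) (A ω, B ω, C ω) * law μ C (C ω) =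
      law μ (fun ω => (A ω, C ω)) (A ω, C ω) * law μ (fun ω => (B ω, C ω)) (B ω, C ω)) :
    cmi μ A B C = 0 := by
  rw [cmi_eq_sum]
  refine Finset.sum_eq_zero fun ω _ => ?_
  by_cases hω : μ ω = 0
  · simp [hω]
  have h1 := law_self_pos (fun ω => (A ω, B ω, C ω)) hω
  have h2 := law_self_pos C hω
  have h3 := law_self_pos (fun ω => (A ω, C ω)) hω
  have h4 := law_self_pos (fun ω => (B ω, C ω)) hω
  have := congrArg Real.log (h ω)
  rw [Real.log_mul h1.ne' h2.ne', Real.log_mul h3.ne' h4.ne'] at this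
  rw [this]
  ring

/-- Apply log x ≤ x - 1 at x = √(q/p) and multiply by 2p. The terms p - q are kept since they cancel
upon summation. -/
theorem sq_sqrt_sub_le_mul_log {p q : ℝ} (hp : 0 < p) (hq : 0 < q) :
    (√p - √q) ^ 2 + p - q ≤ p * (Real.log p - Real.log q) := by
  have hsp := Real.sqrt_pos.mpr hp
  have hsq := Real.sqrt_pos.mpr hq
  have h := Real.log_le_sub_one_of_pos (div_pos hsq hsp)
  rw [Real.log_div hsq.ne' hsp.ne', Real.log_sqrt hp.le, Real.log_sqrt hq.le] at h
  have h2 := mul_le_mul_of_nonneg_left h hp.le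
  have h3 : p * (√q / √p - 1) = √p * √q - p := by
    have : p = √p * √p := (Real.mul_self_sqrt hp.le).symm
    rw [mul_sub, mul_div_assoc', div_eq_iff hsp.ne' |>.mpr (show p * √q = √p * √q * √p by
      nlinarith)]
    ring
  nlinarith [Real.sq_sqrt hp.le, Real.sq_sqrt hq.le]

/-- The information is the divergence of the joint law from the law that makes A and B independent
given C. Both have total mass 1, so the scalar inequality can be summed termwise. -/
theorem hellinger_le_cmi [Fintype α] [Fintype β] [Fintype γ] (μ : Dist Ω)
    (A : Ω → α) (B : Ω → β) (C : Ω → γ) :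
    ∑ x : α × β × γ, (√(law μ (fun ω => (A ω, B ω, C ω)) x) -
      √(law μ (fun ω => (A ω, C ω)) (x.1, x.2.2) * law μ (fun ω => (B ω, C ω)) x.2
        / law μ C x.2.2)) ^ 2 ≤ cmi μ A B C := by
  classical
  have hAC : ∀ c, ∑ a, law μ (fun ω => (A ω, C ω)) (a, c) = law μ C c := fun c => by
    rw [show law μ C c = law μ (fun ω => ((A ω, C ω) : α × γ).2) c from rfl,
      law_comp μ (fun ω => (A ω, C ω)) Prod.snd, Fintype.sum_prod_type]
    simp
  have hBC : ∀ c, ∑ b, law μ (fun ω => (B ω, C ω)) (b, c) = law μ C c := fun c => by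
    rw [show law μ C c = law μ (fun ω => ((B ω, C ω) : β × γ).2) c from rfl,
      law_comp μ (fun ω => (B ω, C ω)) Prod.snd, Fintype.sum_prod_type]
    simp
  have hq : ∑ x : α × β × γ, law μ (fun ω => (A ω, C ω)) (x.1, x.2.2) *
      law μ (fun ω => (B ω, C ω)) x.2 / law μ C x.2.2 = 1 := by
    have : ∀ c, ∑ a, ∑ b, law μ (fun ω => (A ω, C ω)) (a, c) *
        law μ (fun ω => (B ω, C ω)) (b, c) / law μ C c = law μ C c := fun c => by
      simp_rw [mul_div_assoc, ← Finset.mul_sum, ← Finset.sum_div, hBC, ← Finset.sum_mul, hAC]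
      rcases eq_or_ne (law μ C c) 0 with h | h
      · simp [h]
      · field_simp
    simp_rw [Fintype.sum_prod_type]
    rw [← sum_law μ C, ← Finset.sum_congr rfl fun c _ => this c]
    refine Eq.trans ?_ Finset.sum_comm
    refine Finset.sum_congr rfl fun a _ => ?_
    exact Finset.sum_comm
  have hp := sum_law μ (fun ω => (A ω, B ω, C ω))
  rw [cmi_eq_sum, sum_mul_comp μ (fun ω => (A ω, B ω, C ω)) (fun x =>
      Real.log (law μ (fun ω => (A ω, B ω, C ω)) x)
      + Real.log (law μ C x.2.2) - Real.log (law μ (fun ω => (A ω, C ω)) (x.1, x.2.2))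
      - Real.log (law μ (fun ω => (B ω, C ω)) x.2))]
  have key : ∀ x : α × β × γ, (√(law μ (fun ω => (A ω, B ω, C ω)) x) -
      √(law μ (fun ω => (A ω, C ω)) (x.1, x.2.2) * law μ (fun ω => (B ω, C ω)) x.2
        / law μ C x.2.2)) ^ 2 + law μ (fun ω => (A ω, B ω, C ω)) x
      - law μ (fun ω => (A ω, C ω)) (x.1, x.2.2) * law μ (fun ω => (B ω, C ω)) x.2
        / law μ C x.2.2 ≤ law μ (fun ω => (A ω, B ω, C ω)) x *
      (Real.log (law μ (fun ω => (A ω, B ω, C ω)) x)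
      + Real.log (law μ C x.2.2) - Real.log (law μ (fun ω => (A ω, C ω)) (x.1, x.2.2))
      - Real.log (law μ (fun ω => (B ω, C ω)) x.2)) := fun ⟨a, b, c⟩ => by
    rcases (law_nonneg μ (fun ω => (A ω, B ω, C ω)) (a, b, c)).eq_or_lt with h0 | h0
    · rw [← h0]
      simp only [Real.sqrt_zero, zero_sub, neg_sq, zero_mul, add_zero]
      rw [Real.sq_sqrt]
      · simp
      · exact div_nonneg (mul_nonneg (law_nonneg _ _ _) (law_nonneg _ _ _)) (law_nonneg _ _ _)
    · have h1 : 0 < law μ (fun ω => (A ω, C ω)) (a, c) :=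
        h0.trans_le (prob_mono μ fun ω hω => by simp_all)
      have h2 : 0 < law μ (fun ω => (B ω, C ω)) (b, c) :=
        h0.trans_le (prob_mono μ fun ω hω => by simp_all)
      have h3 : 0 < law μ C c := h0.trans_le (prob_mono μ fun ω hω => by simp_all)
      refine (sq_sqrt_sub_le_mul_log h0 (div_pos (mul_pos h1 h2) h3)).trans_eq ?_
      rw [Real.log_div (mul_pos h1 h2).ne' h3.ne', Real.log_mul h1.ne' h2.ne']
      ring
  have := Finset.sum_le_sum fun x (_ : x ∈ Finset.univ) => key x
  rw [Finset.sum_sub_distrib, Finset.sum_add_distrib, hp, hq] at this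
  linarith

theorem cmi_nonneg [Fintype α] [Fintype β] [Fintype γ] (μ : Dist Ω)
    (A : Ω → α) (B : Ω → β) (C : Ω → γ) : 0 ≤ cmi μ A B C :=
  (Finset.sum_nonneg fun _ _ => sq_nonneg _).trans (hellinger_le_cmi μ A B C)

/-- Expand I(A ; B, D | C) by the chain rule in both orders; the extra term I(A ; D | B, C) is
nonnegative. -/
theorem cmi_le_of_cmi_eq_zero [Fintype α] [Fintype β] [Fintype γ] [Fintype δ] (μ : Dist Ω)
    (A : Ω → α) (B : Ω → β) (C : Ω → γ) (D : Ω → δ) (h : cmi μ A D C = 0) :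
    cmi μ A B C ≤ cmi μ A B (fun ω => (C ω, D ω)) := by
  have h' := cmi_nonneg μ A D (fun ω => (B ω, C ω))
  unfold cmi at *
  have e1 : ent μ (fun ω => (A ω, C ω, D ω)) = ent μ (fun ω => (A ω, D ω, C ω)) :=
    ent_congr μ fun ω ω' => by simp only [Prod.mk.injEq]; tauto
  have e2 : ent μ (fun ω => (C ω, D ω)) = ent μ (fun ω => (D ω, C ω)) :=
    ent_congr μ fun ω ω' => by simp only [Prod.mk.injEq]; tauto
  have e3 : ent μ (fun ω => (D ω, B ω, C ω)) = ent μ (fun ω => (B ω, C ω, D ω)) :=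
    ent_congr μ fun ω ω' => by simp only [Prod.mk.injEq]; tauto
  have e4 : ent μ (fun ω => (A ω, D ω, B ω, C ω)) = ent μ (fun ω => (A ω, B ω, C ω, D ω)) :=
    ent_congr μ fun ω ω' => by simp only [Prod.mk.injEq]; tauto
  linarith

/-- If the bit `A` is balanced given every value of `C` in `S`, then `I(A ; B | C)` is at least half
the squared Hellinger distance between the two restrictions of the law of `(B, C)` to `S`. -/
theorem hellinger_le_cmi_of_balanced [Fintype β] [Fintype γ] (μ : Dist Ω)
    (A : Ω → Bool) (B : Ω → β) (C : Ω → γ) (S : Finset γ)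
    (hS : ∀ c ∈ S, law μ (fun ω => (A ω, C ω)) (false, c)
      = law μ (fun ω => (A ω, C ω)) (true, c)) :
    1 / 2 * ∑ c ∈ S, ∑ b, (√(law μ (fun ω => (A ω, B ω, C ω)) (false, b, c)) -
      √(law μ (fun ω => (A ω, B ω, C ω)) (true, b, c))) ^ 2 ≤ cmi μ A B C := by
  classical
  refine le_trans ?_ (hellinger_le_cmi μ A B C)
  rw [Fintype.sum_prod_type, Fintype.sum_bool, ← Finset.sum_add_distrib,
    Fintype.sum_prod_type_right, Finset.mul_sum]
  refine (Finset.sum_le_sum fun c hc => ?_).trans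
    (Finset.sum_le_sum_of_subset_of_nonneg (Finset.subset_univ S) fun c _ _ => ?_)
  swap
  · positivity
  rw [Finset.mul_sum]
  refine Finset.sum_le_sum fun b _ => ?_
  have hC : law μ C c = law μ (fun ω => (A ω, C ω)) (false, c)
      + law μ (fun ω => (A ω, C ω)) (true, c) := by
    simp only [law, prob_setOf, ← Finset.sum_add_distrib]
    refine Finset.sum_congr rfl fun ω _ => ?_
    cases A ω <;> simp
  rw [← hS c hc] at hC ⊢
  rw [hC]
  generalize √(law μ (fun ω => (A ω, C ω)) (false, c) * law μ (fun ω => (B ω, C ω)) (b, c)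
    / _) = m
  generalize √(law μ (fun ω => (A ω, B ω, C ω)) (false, b, c)) = u
  generalize √(law μ (fun ω => (A ω, B ω, C ω)) (true, b, c)) = v
  -- Balance makes the same m serve both values of A, and (u-m)² + (v-m)² = ((u-v)² + (u+v-2m)²)/2.
  nlinarith [sq_nonneg (u + v - 2 * m)]

/-- The chain rule, for the coordinates in increasing order. -/
theorem cmi_chain {n : ℕ} (μ : Dist Ω) (A : Ω → Fin n → α) (B : Ω → β) (C : Ω → γ) :
    cmi μ A B C = ∑ j, cmi μ (fun ω => A ω j) B
      (fun ω => ((fun l : {l // l < j} => A ω l), C ω)) := by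
  -- R m reveals the coordinates below m and masks the others, so the information about R m
  -- telescopes over m.
  let R : ℕ → Ω → (Fin n → Option α) := fun m ω l => if l.val < m then some (A ω l) else none
  have hR : ∀ m ω ω', R m ω = R m ω' ↔ ∀ l : Fin n, l.val < m → A ω l = A ω' l := by
    intro m ω ω'
    simp only [R, funext_iff]
    refine forall_congr' fun l => ?_
    split_ifs <;> simp [*]
  have h := Finset.sum_range_sub (fun m => cmi μ (R m) B C) n
  have h0 : cmi μ (R 0) B C = 0 := by
    unfold cmi
    rw [ent_congr μ (A := fun ω => (R 0 ω, C ω)) (B := C) fun ω ω' => by simp [hR],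
      ent_congr μ (A := fun ω => (R 0 ω, B ω, C ω)) (B := fun ω => (B ω, C ω))
        fun ω ω' => by simp [hR]]
    ring
  have hn : cmi μ (R n) B C = cmi μ A B C :=
    cmi_congr μ (fun ω ω' => by simp [hR, funext_iff]) (fun _ _ => Iff.rfl) fun _ _ => Iff.rfl
  rw [h0, hn, sub_zero] at h
  rw [← h, Finset.sum_range]
  refine Finset.sum_congr rfl fun j _ => ?_
  have hs : ∀ ω ω', R (j + 1) ω = R (j + 1) ω' ↔ A ω j = A ω' j ∧
      (fun l : {l // l < j} => A ω l) = fun l : {l // l < j} => A ω' l := by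
    intro ω ω'
    simp only [hR, funext_iff, Subtype.forall, Nat.lt_succ_iff_lt_or_eq]
    constructor
    · exact fun h => ⟨h j (Or.inr rfl), fun l hl => h l (Or.inl hl)⟩
    · rintro ⟨h1, h2⟩ l (hl | hl)
      · exact h2 l hl
      · rwa [Fin.ext hl]
  have hs' : ∀ ω ω', R j ω = R j ω' ↔
      (fun l : {l // l < j} => A ω l) = fun l : {l // l < j} => A ω' l := by
    intro ω ω'
    simp only [hR, funext_iff, Subtype.forall, Fin.lt_def]
  unfold cmi
  rw [ent_congr μ (A := fun ω => (R (j + 1) ω, C ω))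
      (B := fun ω => (A ω j, (fun l : {l // l < j} => A ω l), C ω))
      fun ω ω' => by simp only [Prod.mk.injEq, hs]; tauto,
    ent_congr μ (A := fun ω => (R (j + 1) ω, B ω, C ω))
      (B := fun ω => (A ω j, B ω, (fun l : {l // l < j} => A ω l), C ω))
      fun ω ω' => by simp only [Prod.mk.injEq, hs]; tauto,
    ent_congr μ (A := fun ω => (R j ω, C ω))
      (B := fun ω => ((fun l : {l // l < j} => A ω l), C ω))
      fun ω ω' => by simp only [Prod.mk.injEq, hs'],
    ent_congr μ (A := fun ω => (R j ω, B ω, C ω))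
      (B := fun ω => (B ω, (fun l : {l // l < j} => A ω l), C ω))
      fun ω ω' => by simp only [Prod.mk.injEq, hs']; tauto]
  ring

/-- The chain rule, for the coordinates in decreasing order. -/
theorem cmi_chain_rev {n : ℕ} (μ : Dist Ω) (A : Ω → Fin n → α) (B : Ω → β) (C : Ω → γ) :
    cmi μ A B C = ∑ j, cmi μ (fun ω => A ω j) B
      (fun ω => ((fun l : {l // j < l} => A ω l), C ω)) := by
  rw [cmi_congr μ (A := A) (A' := fun ω l => A ω (Fin.rev l)) (B' := B) (C' := C)
    (fun ω ω' => ⟨fun h => by rw [h], fun h => funext fun l => by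
      simpa using congrFun h (Fin.rev l)⟩) (fun _ _ => Iff.rfl) (fun _ _ => Iff.rfl),
    cmi_chain, ← Equiv.sum_comp Fin.revPerm]
  refine Finset.sum_congr rfl fun j _ => ?_
  refine cmi_congr μ (fun ω ω' => by simp) (fun _ _ => Iff.rfl) fun ω ω' => ?_
  simp only [Prod.mk.injEq, funext_iff, Subtype.forall]
  refine and_congr_left fun _ => ⟨fun h l hl => ?_, fun h l hl => h _ ?_⟩
  · simpa using h (Fin.rev l) (by simpa using hl)
  · rw [Fin.revPerm_apply] at hl
    rwa [← Fin.rev_lt_rev, Fin.rev_rev]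

end Entropy

/-! ### Transcripts and the rectangle property -/

namespace Protocol

variable {k : ℕ} {I : Type}

/-- All replies in the channel `v` are the ones that player `i` gives on input `x` and coins `s`. -/
def Replies (P : Protocol k I) (i : Fin k) (s : P.Coin) (x : I)
    (v : List (Message × Message)) : Prop :=
  ∀ u q a w, v = u ++ (q, a) :: w → a = P.player i s x u q

/-- The transcript `τ` is possible for the coins `s` of the coordinator. -/
def Possible (P : Protocol k I) (s : P.Coin) (t : ℕ) (τ : List (Exchange k)) : Prop :=
  ∃ X r, P.run X (s, r) t = τ

theorem channel_append (i : Fin k) (τ σ : List (Exchange k)) :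
    channel i (τ ++ σ) = channel i τ ++ channel i σ := by
  simp [channel]

theorem channel_singleton_self (i : Fin k) (q a : Message) :
    channel i [⟨i, q, a⟩] = [(q, a)] := by
  simp [channel]

theorem channel_singleton_of_ne {i l : Fin k} (h : l ≠ i) (q a : Message) :
    channel i [⟨l, q, a⟩] = [] := by
  simp [channel, h]

theorem Replies.of_append {P : Protocol k I} {i : Fin k} {s : P.Coin} {x : I}
    {v w : List (Message × Message)} (h : P.Replies i s x (v ++ w)) : P.Replies i s x v := by
  intro u q a w' hv
  exact h u q a (w' ++ w) (by simp [hv])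

theorem replies_concat {P : Protocol k I} {i : Fin k} {s : P.Coin} {x : I}
    {v : List (Message × Message)} (h : P.Replies i s x v) (q : Message) :
    P.Replies i s x (v ++ [(q, P.player i s x v q)]) := by
  intro u q' a w hv
  rcases List.eq_nil_or_concat w with rfl | ⟨w', e, rfl⟩
  · obtain ⟨rfl, h2⟩ := List.append_inj' hv rfl
    simp only [List.cons.injEq, Prod.mk.injEq, and_true] at h2
    rw [← h2.1, ← h2.2]
  · rw [← List.concat_eq_append, List.concat_eq_append, List.concat_eq_append,
      ← List.cons_append, ← List.append_assoc] at hv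
    exact h u q' a w' (List.append_inj' hv rfl).1

theorem replies_run (P : Protocol k I) (X : Fin k → I) (r : P.Coins) (i : Fin k) (t : ℕ) :
    P.Replies i (r.2 i) (X i) (channel i (P.run X r t)) := by
  induction t with
  | zero => intro u q a w h; simp [run, channel] at h
  | succ t ih =>
    simp only [run]
    rcases P.coordinator r.1 (P.run X r t) with _ | ⟨l, q⟩
    · exact ih
    · simp only [channel_append]
      rcases eq_or_ne l i with rfl | h
      · rw [channel_singleton_self]
        exact replies_concat ih q
      · rwa [channel_singleton_of_ne h, List.append_nil]

/-- The rectangle property: given the coordinator's coins, the set of inputs and players' coins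
that lead to a given transcript is a product set. -/
theorem run_eq_iff (P : Protocol k I) (X : Fin k → I) (r : P.Coins) (t : ℕ)
    (τ : List (Exchange k)) :
    P.run X r t = τ ↔ P.Possible r.1 t τ ∧ ∀ i, P.Replies i (r.2 i) (X i) (channel i τ) := by
  constructor
  · rintro rfl
    exact ⟨⟨X, r.2, rfl⟩, fun i => P.replies_run X r i t⟩
  · rintro ⟨⟨X', r', h⟩, hr⟩
    -- Follow the witnessing run: with the same coins and transcript the coordinator makes the same
    -- query, and consistency of the channel forces the same reply.
    induction t generalizing τ with
    | zero => exact h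
    | succ t ih =>
      simp only [run] at h ⊢
      rcases hc : P.coordinator r.1 (P.run X' (r.1, r') t) with _ | ⟨l, q⟩
      · rw [hc] at h
        have := ih τ hr h
        rw [this]
        simp only at h
        rw [h] at hc
        simp [hc]
      · rw [hc] at h
        simp only at h
        set σ := P.run X' (r.1, r') t
        have hσ := ih σ (fun i => by
          have := hr i
          rw [← h, channel_append] at this
          exact this.of_append) rfl
        rw [hσ, hc, ← h]
        simp only [List.append_cancel_left_eq, List.cons.injEq, Exchange.mk.injEq, true_and,
          and_true]
        have := hr l
        rw [← h, channel_append, channel_singleton_self] at this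
        exact (this _ _ _ [] rfl).symm

end Protocol

/-! ### Hellinger distance -/

section Hellinger

variable {T V : Type*} [Fintype T] [Fintype V]

/-- The squared Hellinger distance, up to normalization. -/
def sqHellinger (f g : V → ℝ) : ℝ := ∑ v, (√(f v) - √(g v)) ^ 2

theorem sqHellinger_nonneg (f g : V → ℝ) : 0 ≤ sqHellinger f g :=
  Finset.sum_nonneg fun _ _ => sq_nonneg _

theorem sqHellinger_comm (f g : V → ℝ) : sqHellinger f g = sqHellinger g f :=
  Finset.sum_congr rfl fun _ _ => by ring

theorem sqHellinger_triangle (f g h : V → ℝ) :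
    sqHellinger f h ≤ 2 * sqHellinger f g + 2 * sqHellinger g h := by
  simp only [sqHellinger, Finset.mul_sum, ← Finset.sum_add_distrib]
  refine Finset.sum_le_sum fun v _ => ?_
  nlinarith [sq_nonneg (√(f v) - 2 * √(g v) + √(h v))]

theorem sqHellinger_eq {f g : V → ℝ} (hf : 0 ≤ f) (hg : 0 ≤ g) :
    sqHellinger f g = ∑ v, f v + ∑ v, g v - 2 * ∑ v, √(f v * g v) := by
  simp only [sqHellinger, Finset.mul_sum, ← Finset.sum_add_distrib, ← Finset.sum_sub_distrib]
  refine Finset.sum_congr rfl fun v _ => ?_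
  rw [Real.sqrt_mul (hf v)]
  linear_combination Real.sq_sqrt (hf v) + Real.sq_sqrt (hg v)

/-- Factor f - g as (√f - √g)(√f + √g) and use Cauchy–Schwarz; the second factor has square sum at
most 4. -/
theorem sq_sum_sub_le_sqHellinger {f g : T → ℝ} (hf : 0 ≤ f) (hg : 0 ≤ g)
    (hf1 : ∑ t, f t = 1) (hg1 : ∑ t, g t = 1) (E : Finset T) :
    (∑ t ∈ E, f t - ∑ t ∈ E, g t) ^ 2 ≤ 4 * sqHellinger f g := by
  have h : ∑ t ∈ E, f t - ∑ t ∈ E, g t =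
      ∑ t ∈ E, (√(f t) - √(g t)) * (√(f t) + √(g t)) := by
    rw [← Finset.sum_sub_distrib]
    refine Finset.sum_congr rfl fun t _ => ?_
    linear_combination -Real.sq_sqrt (hf t) + Real.sq_sqrt (hg t)
  rw [h]
  refine (Finset.sum_mul_sq_le_sq_mul_sq E _ _).trans ?_
  have h1 : ∑ t ∈ E, (√(f t) - √(g t)) ^ 2 ≤ sqHellinger f g :=
    Finset.sum_le_sum_of_subset_of_nonneg (Finset.subset_univ E) fun _ _ _ => sq_nonneg _
  have h2 : ∑ t ∈ E, (√(f t) + √(g t)) ^ 2 ≤ 4 := by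
    calc ∑ t ∈ E, (√(f t) + √(g t)) ^ 2 ≤ ∑ t, (√(f t) + √(g t)) ^ 2 :=
          Finset.sum_le_sum_of_subset_of_nonneg (Finset.subset_univ E) fun _ _ _ => sq_nonneg _
      _ ≤ ∑ t, (2 * f t + 2 * g t) := Finset.sum_le_sum fun t _ => by
          nlinarith [Real.sq_sqrt (hf t), Real.sq_sqrt (hg t), sq_nonneg (√(f t) - √(g t))]
      _ = 4 := by
          rw [Finset.sum_add_distrib, ← Finset.mul_sum, ← Finset.mul_sum, hf1, hg1]
          norm_num
  calc _ ≤ sqHellinger f g * 4 :=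
        mul_le_mul h1 h2 (Finset.sum_nonneg fun _ _ => sq_nonneg _) (sqHellinger_nonneg f g)
    _ = _ := mul_comm _ _

/-- The cut-and-paste property and the Pythagorean property of the Hellinger distance. -/
theorem sqHellinger_cut_paste {p q r s : V → ℝ} (hp : 0 ≤ p) (hq : 0 ≤ q) (hr : 0 ≤ r)
    (hs : 0 ≤ s) (hpr : ∑ v, p v * r v = 1) (hqr : ∑ v, q v * r v = 1)
    (hps : ∑ v, p v * s v = 1) (hqs : ∑ v, q v * s v = 1) :
    sqHellinger (fun v => p v * r v) (fun v => q v * r v) ≤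
      2 * sqHellinger (fun v => q v * r v) (fun v => p v * s v) := by
  have h1 := sqHellinger_nonneg (fun v => p v * s v) (fun v => q v * s v)
  have hpr' : (0 : V → ℝ) ≤ fun v => p v * r v := fun v => mul_nonneg (hp v) (hr v)
  have hqr' : (0 : V → ℝ) ≤ fun v => q v * r v := fun v => mul_nonneg (hq v) (hr v)
  have hps' : (0 : V → ℝ) ≤ fun v => p v * s v := fun v => mul_nonneg (hp v) (hs v)
  have hqs' : (0 : V → ℝ) ≤ fun v => q v * s v := fun v => mul_nonneg (hq v) (hs v)
  have h2 : 2 * ∑ v, √(q v * r v * (p v * s v)) ≤ ∑ v, √(p v * r v * (q v * r v)) +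
      ∑ v, √(p v * s v * (q v * s v)) := by
    rw [← Finset.sum_add_distrib, Finset.mul_sum]
    refine Finset.sum_le_sum fun v _ => ?_
    rw [show q v * r v * (p v * s v) = (p v * q v) * (r v * s v) by ring,
      show p v * r v * (q v * r v) = (p v * q v) * (r v * r v) by ring,
      show p v * s v * (q v * s v) = (p v * q v) * (s v * s v) by ring,
      Real.sqrt_mul (mul_nonneg (hp v) (hq v)), Real.sqrt_mul (mul_nonneg (hp v) (hq v)),
      Real.sqrt_mul (mul_nonneg (hp v) (hq v)), Real.sqrt_mul (hr v), Real.sqrt_mul_self (hr v),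
      Real.sqrt_mul_self (hs v)]
    -- After √(pq) is factored out, the claim is 2√(rs) ≤ r + s.
    have h := mul_nonneg (Real.sqrt_nonneg (p v * q v)) (sq_nonneg (√(r v) - √(s v)))
    rw [sub_sq, Real.sq_sqrt (hr v), Real.sq_sqrt (hs v)] at h
    linarith
  -- As all masses are 1, `h2` says h²(pr, qr) + h²(ps, qs) ≤ 2 h²(qr, ps); the second summand is
  -- discarded by `h1`.
  rw [sqHellinger_eq hps' hqs', hps, hqs] at h1
  rw [sqHellinger_eq hpr' hqr', sqHellinger_eq hqr' hps', hpr, hqr, hps]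
  linarith

end Hellinger

/-- The laws of the transcripts of a protocol whose players have one bit each: the probability of a
transcript is a product of a factor depending on the transcript alone, and of one factor for every
player, which depends only on the view and on the input of this player. -/
structure RectangularFamily (k : ℕ) (T V : Type*) [Fintype T] where
  base : T → ℝ
  factor : Fin k → V → Bool → ℝ
  view : Fin k → T → V
  base_nonneg : 0 ≤ base
  factor_nonneg : ∀ i v b, 0 ≤ factor i v b
  sum_eq_one : ∀ x : Fin k → Bool, ∑ t, base t * ∏ i, factor i (view i t) (x i) = 1

/-! ### One-bit protocols: from views to transcripts -/

namespace RectangularFamily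

variable {k : ℕ} {T V : Type*} [Fintype T] (F : RectangularFamily k T V)

/-- The law of the transcript on input `x`. -/
def full (x : Fin k → Bool) (t : T) : ℝ := F.base t * ∏ i, F.factor i (F.view i t) (x i)

open Classical in
/-- The law of the view of player `i` on input `x`. -/
def viewLaw (i : Fin k) (x : Fin k → Bool) (v : V) : ℝ :=
  ∑ t, if F.view i t = v then F.full x t else 0

/-- The law of the view of player `i` on a uniform input, except that player `i` holds `b`. -/
def mixed (i : Fin k) (b : Bool) (v : V) : ℝ :=
  ∑ x, (1 / 2) ^ k * F.viewLaw i (Function.update x i b) v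

/-- The factor of all participants but player `i`. -/
def others (i : Fin k) (x : Fin k → Bool) (t : T) : ℝ :=
  F.base t * ∏ l ∈ Finset.univ.erase i, F.factor l (F.view l t) (x l)

open Classical in
/-- The total factor of all participants but player `i`, for a given view of player `i`. -/
def rest (i : Fin k) (x : Fin k → Bool) (v : V) : ℝ :=
  ∑ t, if F.view i t = v then F.others i x t else 0

theorem others_nonneg (i : Fin k) (x : Fin k → Bool) (t : T) : 0 ≤ F.others i x t :=
  mul_nonneg (F.base_nonneg t) (Finset.prod_nonneg fun _ _ => F.factor_nonneg _ _ _)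

theorem rest_nonneg (i : Fin k) (x : Fin k → Bool) : 0 ≤ F.rest i x := fun v =>
  Finset.sum_nonneg fun t _ => by split_ifs <;> [exact F.others_nonneg i x t; exact le_rfl]

theorem others_update (i : Fin k) (x : Fin k → Bool) (b : Bool) :
    F.others i (Function.update x i b) = F.others i x := by
  funext t
  unfold others
  congr 1
  refine Finset.prod_congr rfl fun l hl => ?_
  rw [Function.update_of_ne (Finset.ne_of_mem_erase hl)]

theorem rest_update (i : Fin k) (x : Fin k → Bool) (b : Bool) :
    F.rest i (Function.update x i b) = F.rest i x := by
  unfold rest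
  rw [others_update]

theorem full_eq (i : Fin k) (x : Fin k → Bool) (t : T) :
    F.full x t = F.factor i (F.view i t) (x i) * F.others i x t := by
  rw [full, others, ← Finset.mul_prod_erase Finset.univ _ (Finset.mem_univ i)]
  ring

theorem full_nonneg (x : Fin k → Bool) : 0 ≤ F.full x := fun t =>
  mul_nonneg (F.base_nonneg t) (Finset.prod_nonneg fun _ _ => F.factor_nonneg _ _ _)

theorem viewLaw_eq (i : Fin k) (x : Fin k → Bool) (v : V) :
    F.viewLaw i x v = F.factor i v (x i) * F.rest i x v := by
  rw [viewLaw, rest, Finset.mul_sum]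
  refine Finset.sum_congr rfl fun t _ => ?_
  split_ifs with h
  · rw [F.full_eq i, h]
  · simp

/-- Averaging over the other inputs leaves player i's factor intact, so the mixed laws keep the
product form required for cut-and-paste. -/
theorem mixed_eq (i : Fin k) (b : Bool) (v : V) :
    F.mixed i b v = F.factor i v b * ∑ x, (1 / 2) ^ k * F.rest i x v := by
  rw [mixed, Finset.mul_sum]
  refine Finset.sum_congr rfl fun x _ => ?_
  rw [viewLaw_eq, rest_update, Function.update_self]
  ring

variable [Fintype V]

theorem sum_viewLaw (i : Fin k) (x : Fin k → Bool) : ∑ v, F.viewLaw i x v = 1 := by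
  classical
  simp only [viewLaw]
  rw [Finset.sum_comm]
  simpa [full] using F.sum_eq_one x

theorem sum_mixed (i : Fin k) (b : Bool) : ∑ v, F.mixed i b v = 1 := by
  simp only [mixed]
  rw [Finset.sum_comm]
  simp_rw [← Finset.mul_sum, sum_viewLaw]
  simp

/-- Only the factor of player i changes, and it is a function of the view. Each view thus
contributes the same term weighted by the total factor of the others: the rest of the transcript
adds no distance. -/
theorem sqHellinger_full_update (i : Fin k) (x : Fin k → Bool) (b : Bool) :
    sqHellinger (F.full (Function.update x i b)) (F.full x) =
      sqHellinger (F.viewLaw i (Function.update x i b)) (F.viewLaw i x) := by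
  classical
  have key : ∀ {p q r : ℝ}, 0 ≤ p → 0 ≤ q → (√(p * r) - √(q * r)) ^ 2 =
      √r ^ 2 * (√p - √q) ^ 2 := fun hp hq => by
    rw [Real.sqrt_mul hp, Real.sqrt_mul hq]
    ring
  simp only [sqHellinger, F.full_eq i, viewLaw_eq, others_update, rest_update,
    Function.update_self]
  simp only [key (F.factor_nonneg _ _ _) (F.factor_nonneg _ _ _),
    Real.sq_sqrt (F.others_nonneg _ _ _), Real.sq_sqrt (F.rest_nonneg _ _ _)]
  simp only [rest, Finset.sum_mul]
  rw [Finset.sum_comm]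
  refine Finset.sum_congr rfl fun t _ => ?_
  simp

/-- Cut-and-paste with player i's two factors against the rest at `eBar z` and the averaged rest,
then a triangle inequality through the mixed law with bit 1. Each costs a factor 2. -/
theorem sqHellinger_full_eBar_le {i z : Fin k} (h : i ≠ z) :
    sqHellinger (F.full (Function.update (eBar z) i false)) (F.full (eBar z)) ≤
      4 * (sqHellinger (F.mixed i false) (F.mixed i true) +
        sqHellinger (F.mixed i true) (F.viewLaw i (eBar z))) := by
  have hz : eBar z i = true := by simp [eBar, h]
  have h1 := F.sum_viewLaw i (eBar z)
  have h2 := F.sum_viewLaw i (Function.update (eBar z) i false)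
  have h3 := F.sum_mixed i true
  have h4 := F.sum_mixed i false
  rw [sqHellinger_full_update]
  have e1 : F.viewLaw i (eBar z) = fun v => F.factor i v true * F.rest i (eBar z) v := by
    funext v; rw [viewLaw_eq, hz]
  have e2 : F.viewLaw i (Function.update (eBar z) i false) =
      fun v => F.factor i v false * F.rest i (eBar z) v := by
    funext v; rw [viewLaw_eq, rest_update, Function.update_self]
  have e3 := funext (F.mixed_eq i true)
  have e4 := funext (F.mixed_eq i false)
  have t := sqHellinger_triangle (F.viewLaw i (eBar z)) (F.mixed i true) (F.mixed i false)
  rw [sqHellinger_comm (F.viewLaw i (eBar z)) (F.mixed i true),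
    sqHellinger_comm (F.mixed i true) (F.mixed i false)] at t
  have c : sqHellinger (F.viewLaw i (Function.update (eBar z) i false)) (F.viewLaw i (eBar z)) ≤
      2 * sqHellinger (F.viewLaw i (eBar z)) (F.mixed i false) := by
    rw [e1] at h1
    rw [e2] at h2
    rw [e3] at h3
    rw [e4] at h4
    rw [e1, e2, e4]
    exact sqHellinger_cut_paste (fun v => F.factor_nonneg i v false)
      (fun v => F.factor_nonneg i v true) (F.rest_nonneg i _)
      (fun v => Finset.sum_nonneg fun x _ => mul_nonneg (by positivity) (F.rest_nonneg i x v))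
      h2 h1 h4 h3
  linarith

theorem sqHellinger_full_le {i z : Fin k} (h : i ≠ z) :
    sqHellinger (F.full fun _ => true) (F.full (eBar z)) ≤
      24 * (sqHellinger (F.mixed i false) (F.mixed i true) +
        sqHellinger (F.mixed z false) (F.mixed z true) +
        sqHellinger (F.mixed i true) (F.viewLaw i (eBar z)) +
        sqHellinger (F.mixed z true) (F.viewLaw z (eBar i))) := by
  have h1 := F.sqHellinger_full_eBar_le h
  have h2 := F.sqHellinger_full_eBar_le h.symm
  have e : Function.update (eBar i) z false = Function.update (eBar z) i false := by
    funext l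
    simp only [Function.update_apply, eBar]
    split_ifs <;> simp_all
  rw [e] at h2
  set y := Function.update (eBar z) i false
  have h3 : sqHellinger (F.full fun _ => true) (F.full y) =
      sqHellinger (F.full (eBar i)) (F.full (eBar z)) := by
    have hs : ∀ x, ∑ t, F.full x t = 1 := F.sum_eq_one
    rw [sqHellinger_eq (F.full_nonneg _) (F.full_nonneg _),
      sqHellinger_eq (F.full_nonneg _) (F.full_nonneg _), hs, hs, hs, hs]
    congr 2
    refine Finset.sum_congr rfl fun t _ => ?_
    congr 1
    -- Each player holds the same unordered pair of bits in (all-ones, y) as in (`eBar i`, `eBar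
    -- z`), so the products of the densities agree, and with them the Hellinger affinities.
    suffices h : (∏ l, F.factor l (F.view l t) true) * ∏ l, F.factor l (F.view l t) (y l) =
        (∏ l, F.factor l (F.view l t) (eBar i l)) * ∏ l, F.factor l (F.view l t) (eBar z l) by
      unfold full
      linear_combination F.base t ^ 2 * h
    rw [← Finset.prod_mul_distrib, ← Finset.prod_mul_distrib]
    refine Finset.prod_congr rfl fun l _ => ?_
    by_cases hi : l = i
    · subst hi
      simp [y, eBar, h, mul_comm]
    · simp [y, eBar, hi]
  have t1 := sqHellinger_triangle (F.full fun _ => true) (F.full y) (F.full (eBar z))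
  have t2 := sqHellinger_triangle (F.full (eBar i)) (F.full y) (F.full (eBar z))
  rw [sqHellinger_comm (F.full (eBar i)) (F.full y)] at t2
  have n1 := sqHellinger_nonneg (F.mixed i false) (F.mixed i true)
  have n2 := sqHellinger_nonneg (F.mixed z false) (F.mixed z true)
  have n3 := sqHellinger_nonneg (F.mixed i true) (F.viewLaw i (eBar z))
  have n4 := sqHellinger_nonneg (F.mixed z true) (F.viewLaw z (eBar i))
  -- The constant is 24 = 2·8 + 2·4: `t2` bounds h²(`eBar i`, `eBar z`) by 8 times the sum, and `t1`
  -- combines this with `h1`.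
  linarith

/-- If the transcripts on the all-ones input are far from those on every input with a single zero,
then the total distance between the relevant views of the players is linear in their number. -/
theorem le_sum_sqHellinger [NeZero k] {g : ℝ}
    (hg : ∀ z, g ≤ sqHellinger (F.full fun _ => true) (F.full (eBar z))) :
    k * g / 96 ≤ ∑ i, sqHellinger (F.mixed i false) (F.mixed i true) +
      1 / k * ∑ i, ∑ z ∈ Finset.univ.erase i,
        sqHellinger (F.mixed i true) (F.viewLaw i (eBar z)) := by
  set a : Fin k → ℝ := fun i => sqHellinger (F.mixed i false) (F.mixed i true)
  set b : Fin k → Fin k → ℝ := fun i z => sqHellinger (F.mixed i true) (F.viewLaw i (eBar z))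
  have ha : ∀ i, 0 ≤ a i := fun i => sqHellinger_nonneg _ _
  have hb : ∀ i z, 0 ≤ b i z := fun i z => sqHellinger_nonneg _ _
  have hb' : 0 ≤ ∑ i, ∑ z ∈ Finset.univ.erase i, b i z :=
    Finset.sum_nonneg fun i _ => Finset.sum_nonneg fun z _ => hb i z
  have ha' : 0 ≤ ∑ i, a i := Finset.sum_nonneg fun i _ => ha i
  change _ ≤ ∑ i, a i + 1 / k * ∑ i, ∑ z ∈ Finset.univ.erase i, b i z
  -- For k = 1 there is no pair i ≠ z, but the mixed laws are then the view laws of the two inputs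
  -- themselves.
  obtain rfl | hk : k = 1 ∨ 2 ≤ k := by have := NeZero.ne k; omega
  · have h0 : g ≤ a 0 := by
      refine (hg 0).trans_eq ?_
      have h1 : ∀ x : Fin 1 → Bool, Function.update x 0 true = fun _ => true := fun x => by
        funext l; simp [Subsingleton.elim l 0]
      have h2 : ∀ x : Fin 1 → Bool, Function.update x 0 false = eBar 0 := fun x => by
        funext l; simp [Subsingleton.elim l 0, eBar]
      have h3 := F.sqHellinger_full_update 0 (fun _ => true) false
      rw [h2] at h3
      rw [sqHellinger_comm, h3]
      simp only [a]
      congr 1 <;> funext v <;> simp [mixed, h1, h2]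
    have h4 : ∑ i, a i = a 0 := by simp
    rw [h4] at ha' ⊢
    simp only [Nat.cast_one]
    linarith
  · have hk' : (2 : ℝ) ≤ k := by exact_mod_cast hk
    have hcard : ∀ i : Fin k, ((Finset.univ.erase i).card : ℝ) = k - 1 := fun i => by
      rw [Finset.card_erase_of_mem (Finset.mem_univ i), Finset.card_univ, Fintype.card_fin,
        Nat.cast_sub (by omega)]
      simp
    have hsum := Finset.sum_le_sum fun i (_ : i ∈ Finset.univ) =>
      Finset.sum_le_sum fun z (hz : z ∈ Finset.univ.erase i) =>
        (hg z).trans (F.sqHellinger_full_le (Finset.ne_of_mem_erase hz).symm)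
    change ∑ i, ∑ z ∈ Finset.univ.erase i, g ≤ ∑ i, ∑ z ∈ Finset.univ.erase i,
      24 * (a i + a z + b i z + b z i) at hsum
    have hswap : ∀ f : Fin k → Fin k → ℝ, ∑ i, ∑ z ∈ Finset.univ.erase i, f z i =
        ∑ i, ∑ z ∈ Finset.univ.erase i, f i z := fun f =>
      Finset.sum_comm' (by simp [eq_comm])
    have e1 : ∑ i, ∑ z ∈ Finset.univ.erase i, a i = (k - 1) * ∑ i, a i := by
      simp_rw [Finset.sum_const, nsmul_eq_mul, hcard, Finset.mul_sum]
    simp_rw [← Finset.mul_sum, Finset.sum_add_distrib] at hsum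
    rw [hswap b, hswap fun i _ => a i, e1] at hsum
    simp_rw [Finset.sum_const, nsmul_eq_mul, hcard] at hsum
    simp only [Finset.sum_const, Finset.card_univ, Fintype.card_fin, nsmul_eq_mul] at hsum
    set α := ∑ i, a i
    set β := ∑ i, ∑ z ∈ Finset.univ.erase i, b i z
    have hk0 : (0 : ℝ) < k := by linarith
    rw [← sub_nonneg]
    -- Summing over ordered pairs gave k(k-1)g ≤ 48((k-1)α + β). The constant 96 absorbs k ≤ 2(k-1).
    have h5 : 0 ≤ (α + 1 / k * β - k * g / 96) * (48 * k * (k - 1)) := by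
      have e : (α + 1 / k * β - k * g / 96) * (48 * k * (k - 1)) =
        48 * k * (k - 1) * α + 48 * (k - 1) * β - (k * ((k - 1) * g)) * k / 2 := by
        field_simp
        ring
      rw [e]
      have h6 : (k * ((k - 1) * g)) * k / 2 ≤
          24 * ((k - 1) * α + (k - 1) * α + β + β) * k / 2 := by
        gcongr
      have h7 : β * k ≤ β * (2 * (k - 1)) := mul_le_mul_of_nonneg_left (by linarith) hb'
      have h8 : 0 ≤ k * (k - 1) * α := mul_nonneg (mul_nonneg hk0.le (by linarith)) ha'
      nlinarith
    exact nonneg_of_mul_nonneg_left h5 (mul_pos (by linarith) (by linarith))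

end RectangularFamily

/-! ### One coordinate of the hard distribution -/

/-- The values of `(X, M, Z)` for one coordinate. -/
abbrev Sample (k : ℕ) := (Fin k → Bool) × Bool × Fin k

section Mass

variable {k : ℕ}

/-- The mass of `(M, Z)` for one coordinate. -/
def auxMass (mz : Bool × Fin k) : ℝ := 1 / k * (if mz.1 then 1 / 3 else 2 / 3)

/-- The conditional mass of the input bit of player `i`, given `(M, Z)`. -/
def bitMass (i : Fin k) (mz : Bool × Fin k) (b : Bool) : ℝ :=
  if mz.1 then (if b = decide (i ≠ mz.2) then 1 else 0) else 1 / 2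

theorem auxMass_nonneg (mz : Bool × Fin k) : 0 ≤ auxMass mz := by
  unfold auxMass
  split_ifs <;> positivity

theorem bitMass_nonneg (i : Fin k) (mz : Bool × Fin k) (b : Bool) : 0 ≤ bitMass i mz b := by
  unfold bitMass
  split_ifs <;> positivity

theorem xiMass_eq (x : Fin k → Bool) (m : Bool) (z : Fin k) :
    xiMass x m z = auxMass (m, z) * ∏ i, bitMass i (m, z) (x i) := by
  cases m
  · simp [xiMass, auxMass, bitMass, mul_assoc]
  · simp only [xiMass, auxMass, bitMass, Finset.prod_ite_zero, if_true, Finset.prod_const_one,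
      funext_iff, eBar, Finset.mem_univ, forall_true_left, mul_assoc]

theorem xi_apply [NeZero k] (s : Sample k) : xi k s = xiMass s.1 s.2.1 s.2.2 := rfl

end Mass

/-! ### The embedding of one coordinate -/

section Embedding

set_option linter.unusedSectionVars false

variable {k : ℕ} [NeZero k] {I L U : Type} [Finite I] [Fintype L] [Fintype U]
  [DecidableEq L] [DecidableEq U]

/-- The possible transcripts of a protocol. -/
abbrev Protocol.Transcripts (P : Protocol k I) : Type :=
  Set.range fun p : (Fin k → I) × P.Coins => P.transcript p.1 p.2

/-- The possible views of a protocol. -/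
abbrev Protocol.Views (P : Protocol k I) : Type :=
  Set.range fun p : Fin k × P.Transcripts => channel p.1 p.2.1

instance (P : Protocol k I) : Fintype P.Transcripts := Fintype.ofFinite _

instance (P : Protocol k I) : Fintype P.Views := Fintype.ofFinite _

/-- The view of player `i` of a possible transcript. -/
def Protocol.viewOf (P : Protocol k I) (i : Fin k) (τ : P.Transcripts) : P.Views :=
  ⟨channel i τ.1, (i, τ), rfl⟩

variable (L U) in
/-- The samples for the coordinates in `L` and in `U`, and all the coins. -/
abbrev Rest (P : Protocol k I) : Type := (L → Sample k) × (U → Sample k) × P.Coins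

variable (L U) in
/-- The law of the samples for the coordinates in `L` and in `U`, and of the coins. -/
def restLaw (P : Protocol k I) : Dist (Rest L U P) :=
  Dist.prod (Dist.pi fun _ => xi k) (Dist.prod (Dist.pi fun _ => xi k) P.coinLaw)

theorem restLaw_apply (P : Protocol k I) (ω : Rest L U P) :
    restLaw L U P ω = (∏ l, xi k (ω.1 l)) * ((∏ u, xi k (ω.2.1 u)) *
      (P.coordinatorLaw ω.2.2.1 * ∏ i, P.playerLaw i (ω.2.2.2 i))) := rfl

/-- The inputs of the players, if the bits of one coordinate are `x`. -/
def embed (inp : (L → Bool) → Bool → (U → Bool) → I) (P : Protocol k I) (x : Fin k → Bool)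
    (ω : Rest L U P) (i : Fin k) : I :=
  inp (fun l => (ω.1 l).1 i) (x i) (fun u => (ω.2.1 u).1 i)

variable (L U) in
/-- What the coordinator knows at the end, when all players' bits in the coordinates `L` and the
auxiliary variables in the coordinates `U` are public. -/
abbrev Record (P : Protocol k I) : Type :=
  (L → Sample k) × (U → Bool × Fin k) × P.Coin × P.Transcripts

variable (L U) in
/-- What a player knows at the end, apart from the input. -/
abbrev PlayerRecord (P : Protocol k I) : Type :=
  ((L → Bool × Fin k) × (U → Bool × Fin k)) × P.Views

/-- The record, if the bits of one coordinate are `x`. -/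
def record (inp : (L → Bool) → Bool → (U → Bool) → I) (P : Protocol k I) (x : Fin k → Bool)
    (ω : Rest L U P) : Record L U P :=
  (ω.1, fun u => (ω.2.1 u).2, ω.2.2.1,
    ⟨P.transcript (embed inp P x ω) ω.2.2, (embed inp P x ω, ω.2.2), rfl⟩)

/-- The part of the record that a player knows. -/
def playerRecord (P : Protocol k I) (i : Fin k) (t : Record L U P) : PlayerRecord L U P :=
  ((fun l => ((t.1 l).1 i, (t.1 l).2.2), t.2.1), P.viewOf i t.2.2.2)

open Classical in
/-- The factor of the law of the record that does not depend on the players. -/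
def recordBase (P : Protocol k I) (t : Record L U P) : ℝ :=
  if P.Possible t.2.2.1 P.rounds t.2.2.2.1 then
    (∏ l, xi k (t.1 l)) * (∏ u, auxMass (t.2.1 u)) * P.coordinatorLaw t.2.2.1 else 0

open Classical in
/-- The factor of player `i` in the law of the record. -/
def recordFactor (inp : (L → Bool) → Bool → (U → Bool) → I) (P : Protocol k I) (i : Fin k)
    (v : PlayerRecord L U P) (b : Bool) : ℝ :=
  ∑ y : (U → Bool) × P.Coin,
    if P.Replies i y.2 (inp (fun l => (v.1.1 l).1) b y.1) v.2.1 then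
      (∏ u, bitMass i (v.1.2 u) (y.1 u)) * P.playerLaw i y.2 else 0

/-- Separate the public and the private parts of the samples and the coins. -/
def restEquiv (P : Protocol k I) : Rest L U P ≃
    (L → Sample k) × (U → Bool × Fin k) × P.Coin × (Fin k → (U → Bool) × P.Coin) where
  toFun ω := (ω.1, fun u => (ω.2.1 u).2, ω.2.2.1, fun i => (fun u => (ω.2.1 u).1 i, ω.2.2.2 i))
  invFun t := (t.1, fun u => (fun i => (t.2.2.2 i).1 u, t.2.1 u), t.2.2.1, fun i => (t.2.2.2 i).2)
  left_inv _ := rfl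
  right_inv _ := rfl

theorem restLaw_symm_apply (P : Protocol k I) (lo : L → Sample k) (mz : U → Bool × Fin k)
    (s : P.Coin) (y : Fin k → (U → Bool) × P.Coin) :
    restLaw L U P ((restEquiv P).symm (lo, mz, s, y)) =
      (∏ l, xi k (lo l)) * (∏ u, auxMass (mz u)) * P.coordinatorLaw s *
        ∏ i, ((∏ u, bitMass i (mz u) ((y i).1 u)) * P.playerLaw i (y i).2) := by
  rw [restLaw_apply]
  simp only [restEquiv, Equiv.coe_fn_symm_mk, xi_apply, xiMass_eq, Finset.prod_mul_distrib]
  rw [Finset.prod_comm (s := (Finset.univ : Finset U))]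
  ring

theorem record_symm_eq_iff (inp : (L → Bool) → Bool → (U → Bool) → I) (P : Protocol k I)
    (x : Fin k → Bool) (lo : L → Sample k) (mz : U → Bool × Fin k)
    (s : P.Coin) (y : Fin k → (U → Bool) × P.Coin) (t : Record L U P) :
    record inp P x ((restEquiv P).symm (lo, mz, s, y)) = t ↔
      lo = t.1 ∧ mz = t.2.1 ∧ s = t.2.2.1 ∧ P.Possible t.2.2.1 P.rounds t.2.2.2.1 ∧
        ∀ i, P.Replies i (y i).2 (inp (fun l => (t.1 l).1 i) (x i) (y i).1)
          (channel i t.2.2.2.1) := by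
  obtain ⟨lo', mz', s', τ⟩ := t
  have h : record inp P x ((restEquiv P).symm (lo, mz, s, y)) = (lo', mz', s', τ) ↔
      lo = lo' ∧ mz = mz' ∧ s = s' ∧ P.run (embed inp P x ((restEquiv P).symm (lo, mz, s, y)))
        (s, fun i => (y i).2) P.rounds = τ.1 :=
    ⟨fun h => ⟨congrArg (·.1) h, congrArg (·.2.1) h, congrArg (·.2.2.1) h,
      congrArg (·.2.2.2.1) h⟩,
      fun ⟨h1, h2, h3, h4⟩ => Prod.ext h1 (Prod.ext h2 (Prod.ext h3 (Subtype.ext h4)))⟩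
  rw [h, Protocol.run_eq_iff]
  refine ⟨?_, ?_⟩
  · rintro ⟨rfl, rfl, rfl, h1, h2⟩
    exact ⟨rfl, rfl, rfl, h1, h2⟩
  · rintro ⟨rfl, rfl, rfl, h1, h2⟩
    exact ⟨rfl, rfl, rfl, h1, h2⟩

/-- Given (M, Z), input bits are independent across players. Once the public part is fixed, the sum
over private bits and coins therefore distributes over the product of one-player terms. Below the
embedded coordinate M is not part of a player's context, and Z alone need not decouple the players'
bits; this is why whole samples are public there. -/
theorem law_record (inp : (L → Bool) → Bool → (U → Bool) → I) (P : Protocol k I)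
    (x : Fin k → Bool) (t : Record L U P) :
    law (restLaw L U P) (record inp P x) t = recordBase P t *
      ∏ i, recordFactor inp P i (playerRecord P i t) (x i) := by
  classical
  rw [law, prob_setOf, ← (restEquiv P).symm.sum_comp]
  simp_rw [Fintype.sum_prod_type, restLaw_symm_apply, record_symm_eq_iff]
  rw [Finset.sum_eq_single t.1 (fun lo _ h => by simp [h]) (by simp),
    Finset.sum_eq_single t.2.1 (fun lo _ h => by simp [h]) (by simp),
    Finset.sum_eq_single t.2.2.1 (fun lo _ h => by simp [h]) (by simp)]
  simp only [true_and, recordBase]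
  split_ifs with hp
  · simp only [hp, true_and, recordFactor]
    rw [Finset.prod_univ_sum, Fintype.piFinset_univ, Finset.mul_sum]
    refine Finset.sum_congr rfl fun y _ => ?_
    rw [Finset.prod_ite_zero]
    simp only [Finset.mem_univ, forall_true_left, mul_ite, mul_zero]
    rfl
  · simp [hp]

/-- The laws of the records, for the possible bits of one coordinate. -/
def recordFamily (inp : (L → Bool) → Bool → (U → Bool) → I) (P : Protocol k I) :
    RectangularFamily k (Record L U P) (PlayerRecord L U P) where
  base := recordBase P
  factor := recordFactor inp P
  view := playerRecord P
  base_nonneg t := by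
    unfold recordBase
    split_ifs
    · exact mul_nonneg (mul_nonneg (Finset.prod_nonneg fun l _ => (xi k).2.1 _)
        (Finset.prod_nonneg fun u _ => auxMass_nonneg _)) (P.coordinatorLaw.2.1 _)
    · exact le_rfl
  factor_nonneg i v b := Finset.sum_nonneg fun y _ => by
    split_ifs
    · exact mul_nonneg (Finset.prod_nonneg fun u _ => bitMass_nonneg _ _ _)
        ((P.playerLaw i).2.1 _)
    · exact le_rfl
  sum_eq_one x := by
    simp_rw [← law_record inp P x]
    exact sum_law _ _

theorem recordFamily_full (inp : (L → Bool) → Bool → (U → Bool) → I) (P : Protocol k I)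
    (x : Fin k → Bool) :
    (recordFamily inp P).full x = law (restLaw L U P) (record inp P x) :=
  funext fun t => (law_record inp P x t).symm

theorem recordFamily_viewLaw (inp : (L → Bool) → Bool → (U → Bool) → I) (P : Protocol k I)
    (i : Fin k) (x : Fin k → Bool) :
    (recordFamily inp P).viewLaw i x =
      law (restLaw L U P) fun ω => playerRecord P i (record inp P x ω) := by
  funext v
  rw [law_comp (restLaw L U P) (record inp P x) (playerRecord P i), RectangularFamily.viewLaw,
    recordFamily_full]
  rfl

end Embedding

section Split

/-! ### Splitting off one coordinate -/

section Glue

variable {n : ℕ} {α β : Type*}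

/-- The sequence with value `b` at `j`, and with given values below and above `j`. -/
def glue (j : Fin n) (lo : {l // l < j} → α) (b : α) (up : {l // j < l} → α) (l : Fin n) : α :=
  if h : l < j then lo ⟨l, h⟩ else if h : j < l then up ⟨l, h⟩ else b

theorem glue_self (j : Fin n) (lo : {l // l < j} → α) (b : α) (up : {l // j < l} → α) :
    glue j lo b up j = b := by
  simp [glue]

theorem glue_lo (j : Fin n) (lo : {l // l < j} → α) (b : α) (up : {l // j < l} → α)
    (l : {l // l < j}) : glue j lo b up l = lo l := by
  simp [glue, l.2]

theorem glue_up (j : Fin n) (lo : {l // l < j} → α) (b : α) (up : {l // j < l} → α)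
    (l : {l // j < l}) : glue j lo b up l = up l := by
  simp [glue, l.2, l.2.not_gt]

theorem apply_glue (f : α → β) (j : Fin n) (lo : {l // l < j} → α) (b : α)
    (up : {l // j < l} → α) (l : Fin n) :
    f (glue j lo b up l) = glue j (fun l => f (lo l)) (f b) (fun l => f (up l)) l := by
  unfold glue
  split_ifs <;> rfl

theorem glue_restrict (j : Fin n) (t : Fin n → α) :
    glue j (fun l => t l) (t j) (fun l => t l) = t := by
  funext l
  unfold glue
  split_ifs with h1 h2
  · rfl
  · rfl
  · rw [le_antisymm (not_lt.mp h2) (not_lt.mp h1)]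

theorem forall_glue (p : α → Prop) (j : Fin n) (lo : {l // l < j} → α) (b : α)
    (up : {l // j < l} → α) :
    (∀ l, p (glue j lo b up l)) ↔ (∀ l, p (lo l)) ∧ p b ∧ ∀ l, p (up l) := by
  refine ⟨fun h => ⟨fun l => ?_, ?_, fun l => ?_⟩, fun ⟨h1, h2, h3⟩ l => ?_⟩
  · simpa [glue_lo] using h l
  · simpa [glue_self] using h j
  · simpa [glue_up] using h l
  · unfold glue
    split_ifs
    exacts [h1 _, h3 _, h2]

theorem prod_glue (f : α → ℝ) (j : Fin n) (lo : {l // l < j} → α) (b : α)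
    (up : {l // j < l} → α) :
    ∏ l, f (glue j lo b up l) = f b * ((∏ l, f (lo l)) * ∏ l, f (up l)) := by
  have h1 : ∀ l, l ∈ (Finset.univ.erase j).filter (· < j) ↔ l < j := fun l => by
    simp only [Finset.mem_filter, Finset.mem_erase, Finset.mem_univ, and_true]
    exact ⟨fun h => h.2, fun h => ⟨h.ne, h⟩⟩
  have h2 : ∀ l, l ∈ (Finset.univ.erase j).filter (¬ · < j) ↔ j < l := fun l => by
    simp only [Finset.mem_filter, Finset.mem_erase, Finset.mem_univ, and_true, not_lt]
    exact ⟨fun h => h.2.lt_of_ne' h.1, fun h => ⟨h.ne', h.le⟩⟩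
  rw [← Finset.mul_prod_erase Finset.univ _ (Finset.mem_univ j), glue_self,
    ← Finset.prod_filter_mul_prod_filter_not (Finset.univ.erase j) (· < j),
    Finset.prod_subtype (F := Subtype.fintype _) _ h1,
    Finset.prod_subtype (F := Subtype.fintype _) _ h2]
  simp_rw [glue_lo, glue_up]

end Glue

variable {n k : ℕ} [NeZero k]

/-- The inputs, the auxiliary variables and the coins. -/
abbrev Outcome (n : ℕ) {k : ℕ} (P : Protocol k (Fin n → Bool)) : Type :=
  ((Fin k → (Fin n → Bool)) × (Fin n → Bool) × (Fin n → Fin k)) × P.Coins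

/-- The joint law of the inputs, the auxiliary variables and the coins. -/
abbrev outcomeLaw (P : Protocol k (Fin n → Bool)) : Dist (Outcome n P) :=
  Dist.prod (eta n k) P.coinLaw

/-- The values of `(X, M, Z)` at the coordinate `l`. -/
def sampleAt {P : Protocol k (Fin n → Bool)} (ω : Outcome n P) (l : Fin n) : Sample k :=
  (fun i => ω.1.1 i l, ω.1.2.1 l, ω.1.2.2 l)

theorem outcomeLaw_apply (P : Protocol k (Fin n → Bool)) (ω : Outcome n P) :
    outcomeLaw P ω = (∏ l, xi k (sampleAt ω l)) * P.coinLaw ω.2 := rfl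

/-- The outcomes split into the coordinate `j` and the rest. -/
def splitEquiv (P : Protocol k (Fin n → Bool)) (j : Fin n) :
    Sample k × Rest {l // l < j} {l // j < l} P ≃ Outcome n P where
  toFun s := (regroup n k (glue j s.2.1 s.1 s.2.2.1), s.2.2.2)
  invFun ω := (sampleAt ω j, fun l => sampleAt ω l, fun l => sampleAt ω l, ω.2)
  left_inv s := by
    refine Prod.ext ?_ (Prod.ext ?_ (Prod.ext ?_ rfl))
    · exact glue_self j _ _ _
    · exact funext fun l => glue_lo j _ _ _ l
    · exact funext fun l => glue_up j _ _ _ l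
  right_inv ω := by
    change (regroup n k (glue j (fun l => sampleAt ω l) _ fun l => sampleAt ω l), ω.2) = ω
    rw [glue_restrict]
    rfl

omit [NeZero k] in
theorem sampleAt_splitEquiv (P : Protocol k (Fin n → Bool)) (j : Fin n)
    (s : Sample k × Rest {l // l < j} {l // j < l} P) :
    sampleAt (splitEquiv P j s) = glue j s.2.1 s.1 s.2.2.1 := rfl

theorem outcomeLaw_splitEquiv (P : Protocol k (Fin n → Bool)) (j : Fin n)
    (s : Sample k × Rest {l // l < j} {l // j < l} P) :
    outcomeLaw P (splitEquiv P j s) = xi k s.1 * restLaw _ _ P s.2 := by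
  rw [outcomeLaw_apply, sampleAt_splitEquiv, prod_glue (fun t => xi k t), restLaw_apply]
  change _ * _ * (P.coordinatorLaw s.2.2.2.1 * ∏ i, P.playerLaw i (s.2.2.2.2 i)) = _
  ring

theorem prob_outcomeLaw (P : Protocol k (Fin n → Bool)) (j : Fin n) (p : Outcome n P → Prop) :
    prob (outcomeLaw P) {ω | p ω} =
      ∑ s, xi k s * prob (restLaw _ _ P) {ω | p (splitEquiv P j (s, ω))} := by
  classical
  simp_rw [prob_setOf]
  rw [← (splitEquiv P j).sum_comp, Fintype.sum_prod_type]
  refine Finset.sum_congr rfl fun s _ => ?_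
  rw [Finset.mul_sum]
  refine Finset.sum_congr rfl fun ω _ => ?_
  rw [outcomeLaw_splitEquiv, mul_ite, mul_zero]

theorem prob_sample_and {δ : Type*} (P : Protocol k (Fin n → Bool)) (j : Fin n)
    (W : Outcome n P → δ) (W' : (Fin k → Bool) → Rest {l // l < j} {l // j < l} P → δ)
    (hW : ∀ s ω, W (splitEquiv P j (s, ω)) = W' s.1 ω) (i : Fin k) (b m : Bool) (z : Fin k)
    (w : δ) :
    prob (outcomeLaw P) {ω | (ω.1.1 i j = b ∧ ω.1.2.1 j = m ∧ ω.1.2.2 j = z) ∧ W ω = w} =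
      ∑ x, if x i = b then xiMass x m z * law (restLaw _ _ P) (W' x) w else 0 := by
  classical
  have hs : ∀ ω : Outcome n P, (ω.1.1 i j = b ∧ ω.1.2.1 j = m ∧ ω.1.2.2 j = z) ↔
      (sampleAt ω j).1 i = b ∧ (sampleAt ω j).2.1 = m ∧ (sampleAt ω j).2.2 = z :=
    fun ω => Iff.rfl
  simp_rw [hs]
  rw [prob_outcomeLaw P j]
  simp_rw [sampleAt_splitEquiv, glue_self, hW, Fintype.sum_prod_type]
  refine Finset.sum_congr rfl fun x _ => ?_
  rw [Finset.sum_eq_single m (fun m' _ h => by simp [h, prob]) (by simp),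
    Finset.sum_eq_single z (fun z' _ h => by simp [h, prob]) (by simp)]
  by_cases hx : x i = b
  · simp only [hx, true_and, if_true]
    rfl
  · simp [hx, prob]

/-- Overwriting bit i hits each input with that bit exactly twice: from itself and from its flip. -/
theorem sum_ite_eq_half_sum_update {k : ℕ} (i : Fin k) (b : Bool) (f : (Fin k → Bool) → ℝ) :
    ∑ x, (if x i = b then f x else 0) = 1 / 2 * ∑ x, f (Function.update x i b) := by
  set F : (Fin k → Bool) → ℝ := fun x => if x i = b then f x else 0
  have hinv : Function.Involutive fun x : Fin k → Bool => Function.update x i (!x i) :=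
    fun x => by simp
  have h1 : ∑ x, F (Function.update x i (!x i)) = ∑ x, F x := Equiv.sum_comp hinv.toPerm F
  have h2 : ∀ x, f (Function.update x i b) = F x + F (Function.update x i (!x i)) := fun x => by
    by_cases hx : x i = b
    · subst hx
      simp [F]
    · have : (!x i) = b := by revert hx; cases x i <;> cases b <;> simp
      simp [F, this, hx]
  simp_rw [h2, Finset.sum_add_distrib, h1]
  ring

/-- The weight is (1/k)(2/3)(1/2), for Z, M and bit i. -/
theorem prob_sample_false_and {δ : Type*} (P : Protocol k (Fin n → Bool)) (j : Fin n)
    (W : Outcome n P → δ) (W' : (Fin k → Bool) → Rest {l // l < j} {l // j < l} P → δ)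
    (hW : ∀ s ω, W (splitEquiv P j (s, ω)) = W' s.1 ω) (i : Fin k) (b : Bool) (z : Fin k)
    (w : δ) :
    prob (outcomeLaw P) {ω | (ω.1.1 i j = b ∧ ω.1.2.1 j = false ∧ ω.1.2.2 j = z) ∧ W ω = w} =
      1 / (3 * k) * ∑ x, (1 / 2) ^ k *
        law (restLaw _ _ P) (W' (Function.update x i b)) w := by
  rw [prob_sample_and P j W W' hW, sum_ite_eq_half_sum_update i b fun x =>
    xiMass x false z * law (restLaw _ _ P) (W' x) w, Finset.mul_sum, Finset.mul_sum]
  refine Finset.sum_congr rfl fun x _ => ?_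
  simp only [xiMass, Bool.false_eq_true, if_false]
  field_simp

/-- The weight is (1/k)(1/3), the same as for M = 0 with a prescribed bit. This coincidence balances
M given X^i = 1 and Z ≠ i. -/
theorem prob_sample_true_and {δ : Type*} (P : Protocol k (Fin n → Bool)) (j : Fin n)
    (W : Outcome n P → δ) (W' : (Fin k → Bool) → Rest {l // l < j} {l // j < l} P → δ)
    (hW : ∀ s ω, W (splitEquiv P j (s, ω)) = W' s.1 ω) {i z : Fin k} (hz : i ≠ z) (w : δ) :
    prob (outcomeLaw P) {ω | (ω.1.1 i j = true ∧ ω.1.2.1 j = true ∧ ω.1.2.2 j = z) ∧ W ω = w} =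
      1 / (3 * k) * law (restLaw _ _ P) (W' (eBar z)) w := by
  rw [prob_sample_and P j W W' hW, Finset.sum_eq_single (eBar z)]
  · have : eBar z i = true := by simp [eBar, hz]
    simp only [this, xiMass, if_true]
    field_simp
  · intro x _ hx
    simp [xiMass, hx]
  · simp

/-! ### Independence of the coordinates -/

theorem prob_forall_sampleAt (P : Protocol k (Fin n → Bool)) (E : Fin n → Set (Sample k)) :
    prob (outcomeLaw P) {ω | ∀ l, sampleAt ω l ∈ E l} = ∏ l, prob (xi k) (E l) := by
  classical
  rw [prob_setOf, Fintype.sum_prod_type, ← (regroup n k).sum_comp]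
  have h : ∑ r, P.coinLaw r = 1 := P.coinLaw.2.2
  have e : ∀ (t : Fin n → Sample k) (r : P.Coins),
      (@ite _ (∀ l, sampleAt (P := P) (regroup n k t, r) l ∈ E l) (Classical.propDecidable _)
        (outcomeLaw P (regroup n k t, r)) 0) =
      (∏ l, if t l ∈ E l then xi k (t l) else 0) * P.coinLaw r := fun t r => by
    rw [Finset.prod_ite_zero, ite_mul, zero_mul]
    simp only [Finset.mem_univ, forall_true_left]
    congr
  simp_rw [e, ← Finset.mul_sum, h, mul_one]
  simp_rw [prob, Set.indicator_apply]
  rw [Finset.prod_univ_sum, Fintype.piFinset_univ]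

theorem law_sampleAt {α : Type*} (P : Protocol k (Fin n → Bool))
    (f : Fin n → Sample k → α) (ω : Outcome n P) :
    law (outcomeLaw P) (fun ω l => f l (sampleAt ω l)) (fun l => f l (sampleAt ω l)) =
      ∏ l, law (xi k) (f l) (f l (sampleAt ω l)) := by
  simp only [law, funext_iff]
  exact prob_forall_sampleAt P fun l => {s | f l s = f l (sampleAt ω l)}

/-- Conditional independence of functions of disjoint sets of coordinates. -/
theorem cmi_sampleAt_eq_zero {α β γ : Type*} (P : Protocol k (Fin n → Bool))
    (a : Fin n → Sample k → α) (d : Fin n → Sample k → β) (c : Fin n → Sample k → γ)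
    (h : ∀ l, (∀ s s', a l s = a l s') ∨ ∀ s s', d l s = d l s') :
    cmi (outcomeLaw P) (fun ω l => a l (sampleAt ω l)) (fun ω l => d l (sampleAt ω l))
      (fun ω l => c l (sampleAt ω l)) = 0 := by
  refine cmi_eq_zero _ _ _ _ fun ω => ?_
  rw [law_congr (outcomeLaw P) (B := fun ω l =>
      (a l (sampleAt ω l), d l (sampleAt ω l), c l (sampleAt ω l)))
      (fun ω ω' => by simp only [Prod.mk.injEq, funext_iff, forall_and]),
    law_congr (outcomeLaw P) (A := fun ω => (fun l => a l (sampleAt ω l), fun l =>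
      c l (sampleAt ω l))) (B := fun ω l => (a l (sampleAt ω l), c l (sampleAt ω l)))
      (fun ω ω' => by simp only [Prod.mk.injEq, funext_iff, forall_and]),
    law_congr (outcomeLaw P) (A := fun ω => (fun l => d l (sampleAt ω l), fun l =>
      c l (sampleAt ω l))) (B := fun ω l => (d l (sampleAt ω l), c l (sampleAt ω l)))
      (fun ω ω' => by simp only [Prod.mk.injEq, funext_iff, forall_and]),
    law_sampleAt P (fun l s => (a l s, d l s, c l s)), law_sampleAt P c,
    law_sampleAt P (fun l s => (a l s, c l s)), law_sampleAt P (fun l s => (d l s, c l s)),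
    ← Finset.prod_mul_distrib, ← Finset.prod_mul_distrib]
  refine Finset.prod_congr rfl fun l _ => ?_
  rcases h l with h | h
  · rw [law_congr (xi k) (A := fun s => (a l s, d l s, c l s)) (B := fun s => (d l s, c l s))
        (fun s s' => by simp [h s s']),
      law_congr (xi k) (A := fun s => (a l s, c l s)) (B := c l) (fun s s' => by simp [h s s'])]
    ring
  · rw [law_congr (xi k) (A := fun s => (a l s, d l s, c l s)) (B := fun s => (a l s, c l s))
        (fun s s' => by simp [h s s']),
      law_congr (xi k) (A := fun s => (d l s, c l s)) (B := c l) (fun s s' => by simp [h s s'])]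

end Split

section DirectSum

variable {n k : ℕ} [NeZero k]

/-! ### The information revealed about one coordinate -/

/-- The view of player `i`, as a random variable with finitely many values. -/
def viewVar (P : Protocol k (Fin n → Bool)) (i : Fin k) (ω : Outcome n P) : P.Views :=
  P.viewOf i ⟨P.transcript ω.1.1 ω.2, (ω.1.1, ω.2), rfl⟩

/-- The bits of player `i` below the coordinate `j`, the values of `M` above `j`, and the values of
`Z` at all coordinates but `j`. -/
def contextVar (P : Protocol k (Fin n → Bool)) (i : Fin k) (j : Fin n) (ω : Outcome n P) :
    ({l // l < j} → Bool × Fin k) × ({l // j < l} → Bool × Fin k) :=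
  (fun l => (ω.1.1 i l, ω.1.2.2 l), fun l => (ω.1.2.1 l, ω.1.2.2 l))

/-- `contextVar` as a function of the coordinates other than `j`. -/
def restContext (P : Protocol k (Fin n → Bool)) (i : Fin k) (j : Fin n)
    (ω : Rest {l // l < j} {l // j < l} P) :
    ({l // l < j} → Bool × Fin k) × ({l // j < l} → Bool × Fin k) :=
  (fun l => ((ω.1 l).1 i, (ω.1 l).2.2), fun l => (ω.2.1 l).2)

omit [NeZero k] in
theorem embed_glue (P : Protocol k (Fin n → Bool)) (j : Fin n) (x : Fin k → Bool)
    (ω : Rest {l // l < j} {l // j < l} P) (s : Bool × Fin k) :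
    embed (glue j) P x ω = (splitEquiv P j ((x, s), ω)).1.1 := by
  funext i l
  exact (apply_glue (fun t : Sample k => t.1 i) j ω.1 (x, s) ω.2.1 l).symm

omit [NeZero k] in
theorem contextVar_splitEquiv (P : Protocol k (Fin n → Bool)) (i : Fin k) (j : Fin n)
    (s : Sample k) (ω : Rest {l // l < j} {l // j < l} P) :
    contextVar P i j (splitEquiv P j (s, ω)) =
      restContext P i j ω := by
  refine Prod.ext (funext fun l => ?_) (funext fun l => ?_)
  · exact congrArg (fun t : Sample k => (t.1 i, t.2.2)) (glue_lo j ω.1 s ω.2.1 l)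
  · exact congrArg (fun t : Sample k => t.2) (glue_up j ω.1 s ω.2.1 l)

omit [NeZero k] in
theorem contextVar_viewVar_splitEquiv (P : Protocol k (Fin n → Bool)) (i : Fin k) (j : Fin n)
    (s : Sample k) (ω : Rest {l // l < j} {l // j < l} P) :
    (contextVar P i j (splitEquiv P j (s, ω)), viewVar P i (splitEquiv P j (s, ω))) =
      playerRecord P i (record (glue j) P s.1 ω) := by
  refine Prod.ext (contextVar_splitEquiv P i j s ω) (Subtype.ext ?_)
  change channel i (P.transcript (splitEquiv P j (s, ω)).1.1 ω.2.2) =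
    channel i (P.transcript (embed (glue j) P s.1 ω) ω.2.2)
  rw [embed_glue P j s.1 ω s.2]

theorem mixed_glue (P : Protocol k (Fin n → Bool)) (i : Fin k) (j : Fin n) (b : Bool)
    (z : Fin k) (w : PlayerRecord {l // l < j} {l // j < l} P) :
    prob (outcomeLaw P) {ω | (ω.1.1 i j = b ∧ ω.1.2.1 j = false ∧ ω.1.2.2 j = z) ∧
      (contextVar P i j ω, viewVar P i ω) = w} =
      1 / (3 * k) * (recordFamily (glue j) P).mixed i b w := by
  rw [prob_sample_false_and P j (fun ω => (contextVar P i j ω, viewVar P i ω))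
    (fun x ω => playerRecord P i (record (glue j) P x ω))
    (contextVar_viewVar_splitEquiv P i j), RectangularFamily.mixed]
  simp_rw [recordFamily_viewLaw]

theorem viewLaw_glue (P : Protocol k (Fin n → Bool)) {i z : Fin k} (hz : i ≠ z) (j : Fin n)
    (w : PlayerRecord {l // l < j} {l // j < l} P) :
    prob (outcomeLaw P) {ω | (ω.1.1 i j = true ∧ ω.1.2.1 j = true ∧ ω.1.2.2 j = z) ∧
      (contextVar P i j ω, viewVar P i ω) = w} =
      1 / (3 * k) * (recordFamily (glue j) P).viewLaw i (eBar z) w := by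
  rw [prob_sample_true_and P j (fun ω => (contextVar P i j ω, viewVar P i ω))
    (fun x ω => playerRecord P i (record (glue j) P x ω))
    (contextVar_viewVar_splitEquiv P i j) hz, recordFamily_viewLaw]

/-- The context involves only the other coordinates, so it does not disturb the balance at j. -/
theorem prob_contextVar_false (P : Protocol k (Fin n → Bool)) (i : Fin k) (j : Fin n) (b : Bool)
    (z : Fin k) (w : ({l // l < j} → Bool × Fin k) × ({l // j < l} → Bool × Fin k)) :
    prob (outcomeLaw P) {ω | (ω.1.1 i j = b ∧ ω.1.2.1 j = false ∧ ω.1.2.2 j = z) ∧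
      contextVar P i j ω = w} =
      1 / (3 * k) * law (restLaw _ _ P) (restContext P i j) w := by
  rw [prob_sample_false_and P j (contextVar P i j) (fun _ => restContext P i j)
    (contextVar_splitEquiv P i j), ← Finset.sum_mul]
  simp

theorem prob_contextVar_true (P : Protocol k (Fin n → Bool)) {i z : Fin k} (hz : i ≠ z)
    (j : Fin n) (w : ({l // l < j} → Bool × Fin k) × ({l // j < l} → Bool × Fin k)) :
    prob (outcomeLaw P) {ω | (ω.1.1 i j = true ∧ ω.1.2.1 j = true ∧ ω.1.2.2 j = z) ∧
      contextVar P i j ω = w} =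
      1 / (3 * k) * law (restLaw _ _ P) (restContext P i j) w :=
  prob_sample_true_and P j (contextVar P i j) (fun _ => restContext P i j) (contextVar_splitEquiv P i j) hz w

theorem sq_sqrt_mul_sub_sqrt_mul {c a b : ℝ} (hc : 0 ≤ c) :
    (√(c * a) - √(c * b)) ^ 2 = c * (√a - √b) ^ 2 := by
  rw [Real.sqrt_mul hc, Real.sqrt_mul hc, ← mul_sub, mul_pow, Real.sq_sqrt hc]

theorem sqHellinger_mixed_le_cmi (P : Protocol k (Fin n → Bool)) (i : Fin k) (j : Fin n) :
    1 / 6 * sqHellinger ((recordFamily (glue j) P).mixed i false)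
      ((recordFamily (glue j) P).mixed i true) ≤
    cmi (outcomeLaw P) (fun ω => ω.1.1 i j) (viewVar P i)
      (fun ω => (contextVar P i j ω, ω.1.2.1 j, ω.1.2.2 j)) := by
  have hk : (k : ℝ) ≠ 0 := Nat.cast_ne_zero.mpr (NeZero.ne k)
  -- Restrict to M = 0, where the bit is uniform. The constant is 1/6 = (1/2)·k·1/(3k), from k equal
  -- values of z.
  refine le_trans (le_of_eq ?_) (hellinger_le_cmi_of_balanced (outcomeLaw P) _ _ _
    (Finset.univ ×ˢ ({false} ×ˢ Finset.univ)) ?_)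
  · have h : ∀ b v κ z, law (outcomeLaw P) (fun ω => (ω.1.1 i j, viewVar P i ω,
        contextVar P i j ω, ω.1.2.1 j, ω.1.2.2 j)) (b, v, κ, false, z) =
        1 / (3 * k) * (recordFamily (glue j) P).mixed i b (κ, v) := fun b v κ z => by
      rw [← mixed_glue P i j b z]
      refine congrArg _ (Set.ext fun ω => ?_)
      simp only [Set.mem_ofPred_eq, Prod.ext_iff]
      tauto
    simp_rw [Finset.sum_product, Finset.sum_singleton, h,
      sq_sqrt_mul_sub_sqrt_mul (show (0 : ℝ) ≤ 1 / (3 * k) by positivity), ← Finset.mul_sum]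
    rw [sqHellinger, Fintype.sum_prod_type]
    simp only [Finset.sum_const, Finset.card_univ, Fintype.card_fin, nsmul_eq_mul,
      ← Finset.mul_sum]
    field_simp
    ring
  · rintro ⟨κ, m, z⟩ hc
    obtain rfl : m = false := by simpa using hc
    have h : ∀ b, law (outcomeLaw P) (fun ω => (ω.1.1 i j,
        contextVar P i j ω, ω.1.2.1 j, ω.1.2.2 j)) (b, κ, false, z) =
        prob (outcomeLaw P) {ω | (ω.1.1 i j = b ∧ ω.1.2.1 j = false ∧ ω.1.2.2 j = z) ∧
          contextVar P i j ω = κ} := fun b => by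
      refine congrArg _ (Set.ext fun ω => ?_)
      simp only [Set.mem_ofPred_eq, Prod.ext_iff]
      tauto
    rw [h, h, prob_contextVar_false, prob_contextVar_false]

theorem sqHellinger_eBar_le_cmi (P : Protocol k (Fin n → Bool)) (i : Fin k) (j : Fin n) :
    1 / 6 * (1 / k * ∑ z ∈ Finset.univ.erase i,
      sqHellinger ((recordFamily (glue j) P).mixed i true)
      ((recordFamily (glue j) P).viewLaw i (eBar z))) ≤
    cmi (outcomeLaw P) (fun ω => ω.1.2.1 j) (viewVar P i)
      (fun ω => (contextVar P i j ω, ω.1.1 i j, ω.1.2.2 j)) := by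
  have hk : (k : ℝ) ≠ 0 := Nat.cast_ne_zero.mpr (NeZero.ne k)
  -- Restrict to own bit 1 and z ≠ i, where M is balanced. Here the laws depend on z, so the sum
  -- over z stays.
  refine le_trans (le_of_eq ?_) (hellinger_le_cmi_of_balanced (outcomeLaw P) _ _ _
    (Finset.univ ×ˢ ({true} ×ˢ Finset.univ.erase i)) ?_)
  · have h : ∀ v κ z, law (outcomeLaw P) (fun ω => (ω.1.2.1 j, viewVar P i ω,
        contextVar P i j ω, ω.1.1 i j, ω.1.2.2 j)) (false, v, κ, true, z) =
        1 / (3 * k) * (recordFamily (glue j) P).mixed i true (κ, v) := fun v κ z => by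
      rw [← mixed_glue P i j true z]
      refine congrArg _ (Set.ext fun ω => ?_)
      simp only [Set.mem_ofPred_eq, Prod.ext_iff]
      tauto
    have h' : ∀ v κ, ∀ z ∈ Finset.univ.erase i, law (outcomeLaw P) (fun ω => (ω.1.2.1 j,
        viewVar P i ω, contextVar P i j ω, ω.1.1 i j, ω.1.2.2 j)) (true, v, κ, true, z) =
        1 / (3 * k) * (recordFamily (glue j) P).viewLaw i (eBar z) (κ, v) := fun v κ z hz => by
      rw [← viewLaw_glue P (Finset.ne_of_mem_erase hz).symm j]
      refine congrArg _ (Set.ext fun ω => ?_)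
      simp only [Set.mem_ofPred_eq, Prod.ext_iff]
      tauto
    simp_rw [Finset.sum_product, Finset.sum_singleton]
    rw [Finset.sum_comm, Finset.mul_sum, Finset.mul_sum, Finset.mul_sum]
    refine Finset.sum_congr rfl fun z hz => ?_
    simp_rw [h, fun v κ => h' v κ z hz,
      sq_sqrt_mul_sub_sqrt_mul (show (0 : ℝ) ≤ 1 / (3 * k) by positivity), ← Finset.mul_sum]
    rw [sqHellinger, Fintype.sum_prod_type]
    field_simp
    ring
  · rintro ⟨κ, b, z⟩ hc
    obtain ⟨rfl, hz⟩ : b = true ∧ z ≠ i := by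
      simp only [Finset.mem_product, Finset.mem_singleton, Finset.mem_erase] at hc
      exact ⟨hc.2.1, hc.2.2.1⟩
    have h : ∀ m, law (outcomeLaw P) (fun ω => (ω.1.2.1 j,
        contextVar P i j ω, ω.1.1 i j, ω.1.2.2 j)) (m, κ, true, z) =
        prob (outcomeLaw P) {ω | (ω.1.1 i j = true ∧ ω.1.2.1 j = m ∧ ω.1.2.2 j = z) ∧
          contextVar P i j ω = κ} := fun m => by
      refine congrArg _ (Set.ext fun ω => ?_)
      simp only [Set.mem_ofPred_eq, Prod.ext_iff]
      tauto
    rw [h, h, prob_contextVar_false, prob_contextVar_true P hz.symm]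

/-! ### The direct sum -/

/-- The increasing chain rule conditions on X^i below j and on all of M, Z. Given the context, M
below j is independent of X^i at j, so omitting it from the conditioning only lowers the
information. -/
theorem sum_cmi_input_le (P : Protocol k (Fin n → Bool)) (i : Fin k) :
    ∑ j, cmi (outcomeLaw P) (fun ω => ω.1.1 i j) (viewVar P i)
      (fun ω => (contextVar P i j ω, ω.1.2.1 j, ω.1.2.2 j)) ≤
    cmi (outcomeLaw P) (fun ω => ω.1.1 i) (viewVar P i) (fun ω => (ω.1.2.1, ω.1.2.2)) := by
  rw [cmi_chain (outcomeLaw P) (fun ω => ω.1.1 i)]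
  refine Finset.sum_le_sum fun j _ => ?_
  -- Everything is written as coordinatewise functions, with `none` for what is hidden; the bit
  -- lives at j only and the omitted M strictly below j.
  have h0 := cmi_sampleAt_eq_zero P (fun l s => if l = j then some (s.1 i) else none)
    (fun l s => if l < j then some s.2.1 else none)
    (fun l s => (if l < j then s.1 i else s.2.1, s.2.2)) (fun l => by
      by_cases h : l < j
      · exact Or.inl fun s s' => by simp [h.ne]
      · exact Or.inr fun s s' => by simp [h])
  have hC : ∀ ω ω' : Outcome n P,
      (contextVar P i j ω, ω.1.2.1 j, ω.1.2.2 j) = (contextVar P i j ω', ω'.1.2.1 j, ω'.1.2.2 j) ↔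
      ∀ l, (l < j → ω.1.1 i l = ω'.1.1 i l) ∧ (j ≤ l → ω.1.2.1 l = ω'.1.2.1 l) ∧
        ω.1.2.2 l = ω'.1.2.2 l := fun ω ω' => by
    simp only [contextVar, Prod.mk.injEq, funext_iff, Subtype.forall]
    constructor
    · rintro ⟨⟨h1, h2⟩, h3, h4⟩ l
      rcases lt_trichotomy l j with h | rfl | h
      · exact ⟨fun _ => (h1 l h).1, fun h' => absurd h h'.not_gt, (h1 l h).2⟩
      · exact ⟨fun h' => absurd h' (lt_irrefl l), fun _ => h3, h4⟩
      · exact ⟨fun h' => absurd h h'.not_gt, fun _ => (h2 l h).1, (h2 l h).2⟩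
    · intro h
      exact ⟨⟨fun l hl => ⟨(h l).1 hl, (h l).2.2⟩, fun l hl => ⟨(h l).2.1 hl.le, (h l).2.2⟩⟩,
        (h j).2.1 le_rfl, (h j).2.2⟩
  have hD : ∀ ω ω' : Outcome n P,
      (fun l => if l < j then some (sampleAt ω l).2.1 else none) =
        (fun l => if l < j then some (sampleAt ω' l).2.1 else none) ↔
      ∀ l, l < j → ω.1.2.1 l = ω'.1.2.1 l := fun ω ω' => by
    simp only [funext_iff]
    refine forall_congr' fun l => ?_
    by_cases h : l < j <;> simp [h, sampleAt]
  have h1 : cmi (outcomeLaw P) (fun ω => ω.1.1 i j)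
      (fun ω l => if l < j then some (sampleAt ω l).2.1 else none)
      (fun ω => (contextVar P i j ω, ω.1.2.1 j, ω.1.2.2 j)) = 0 := by
    rw [← h0]
    refine cmi_congr _ (fun ω ω' => ?_) (fun _ _ => Iff.rfl) (fun ω ω' => ?_)
    · simp only [funext_iff]
      refine ⟨fun h l => ?_, fun h => by simpa [sampleAt] using h j⟩
      by_cases hl : l = j
      · subst hl
        simpa [sampleAt] using h
      · simp [hl]
    · rw [hC]
      simp only [funext_iff]
      refine forall_congr' fun l => ?_
      by_cases hl : l < j
      · simp [hl, sampleAt]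
      · simp [hl, sampleAt, not_lt.mp hl]
  refine (cmi_le_of_cmi_eq_zero _ _ (viewVar P i) _ _ h1).trans_eq ?_
  refine cmi_congr _ (fun _ _ => Iff.rfl) (fun _ _ => Iff.rfl) fun ω ω' => ?_
  rw [Prod.ext_iff, hC, hD]
  simp only [Prod.mk.injEq, funext_iff, Subtype.forall]
  constructor
  · rintro ⟨h1, h2⟩
    exact ⟨fun l => (h1 l).1, fun l => (lt_or_ge l j).elim (h2 l) (h1 l).2.1,
      fun l => (h1 l).2.2⟩
  · rintro ⟨h1, h2, h3⟩
    exact ⟨fun l => ⟨h1 l, fun _ => h2 l, h3 l⟩, fun l _ => h2 l⟩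

/-- The mirror image: the decreasing order leaves M above j, and X^i above j is omitted by
independence. The resulting context is the one used for the input term. -/
theorem sum_cmi_aux_le (P : Protocol k (Fin n → Bool)) (i : Fin k) :
    ∑ j, cmi (outcomeLaw P) (fun ω => ω.1.2.1 j) (viewVar P i)
      (fun ω => (contextVar P i j ω, ω.1.1 i j, ω.1.2.2 j)) ≤
    cmi (outcomeLaw P) (fun ω => ω.1.2.1) (viewVar P i) (fun ω => (ω.1.1 i, ω.1.2.2)) := by
  rw [cmi_chain_rev (outcomeLaw P) (fun ω => ω.1.2.1)]
  refine Finset.sum_le_sum fun j _ => ?_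
  have h0 := cmi_sampleAt_eq_zero P (fun l s => if l = j then some s.2.1 else none)
    (fun l s => if j < l then some (s.1 i) else none)
    (fun l s => (if j < l then s.2.1 else s.1 i, s.2.2)) (fun l => by
      by_cases h : j < l
      · exact Or.inl fun s s' => by simp [h.ne']
      · exact Or.inr fun s s' => by simp [h])
  have hC : ∀ ω ω' : Outcome n P,
      (contextVar P i j ω, ω.1.1 i j, ω.1.2.2 j) = (contextVar P i j ω', ω'.1.1 i j, ω'.1.2.2 j) ↔
      ∀ l, (j < l → ω.1.2.1 l = ω'.1.2.1 l) ∧ (l ≤ j → ω.1.1 i l = ω'.1.1 i l) ∧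
        ω.1.2.2 l = ω'.1.2.2 l := fun ω ω' => by
    simp only [contextVar, Prod.mk.injEq, funext_iff, Subtype.forall]
    constructor
    · rintro ⟨⟨h1, h2⟩, h3, h4⟩ l
      rcases lt_trichotomy l j with h | rfl | h
      · exact ⟨fun h' => absurd h h'.not_gt, fun _ => (h1 l h).1, (h1 l h).2⟩
      · exact ⟨fun h' => absurd h' (lt_irrefl l), fun _ => h3, h4⟩
      · exact ⟨fun _ => (h2 l h).1, fun h' => absurd h h'.not_gt, (h2 l h).2⟩
    · intro h
      exact ⟨⟨fun l hl => ⟨(h l).2.1 hl.le, (h l).2.2⟩, fun l hl => ⟨(h l).1 hl, (h l).2.2⟩⟩,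
        (h j).2.1 le_rfl, (h j).2.2⟩
  have hD : ∀ ω ω' : Outcome n P,
      (fun l => if j < l then some ((sampleAt ω l).1 i) else none) =
        (fun l => if j < l then some ((sampleAt ω' l).1 i) else none) ↔
      ∀ l, j < l → ω.1.1 i l = ω'.1.1 i l := fun ω ω' => by
    simp only [funext_iff]
    refine forall_congr' fun l => ?_
    by_cases h : j < l <;> simp [h, sampleAt]
  have h1 : cmi (outcomeLaw P) (fun ω => ω.1.2.1 j)
      (fun ω l => if j < l then some ((sampleAt ω l).1 i) else none)
      (fun ω => (contextVar P i j ω, ω.1.1 i j, ω.1.2.2 j)) = 0 := by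
    rw [← h0]
    refine cmi_congr _ (fun ω ω' => ?_) (fun _ _ => Iff.rfl) (fun ω ω' => ?_)
    · simp only [funext_iff]
      refine ⟨fun h l => ?_, fun h => by simpa [sampleAt] using h j⟩
      by_cases hl : l = j
      · subst hl
        simpa [sampleAt] using h
      · simp [hl]
    · rw [hC]
      simp only [funext_iff]
      refine forall_congr' fun l => ?_
      by_cases hl : j < l
      · simp [hl, sampleAt]
      · simp [hl, sampleAt, not_lt.mp hl]
  refine (cmi_le_of_cmi_eq_zero _ _ (viewVar P i) _ _ h1).trans_eq ?_
  refine cmi_congr _ (fun _ _ => Iff.rfl) (fun _ _ => Iff.rfl) fun ω ω' => ?_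
  rw [Prod.ext_iff, hC, hD]
  simp only [Prod.mk.injEq, funext_iff, Subtype.forall]
  constructor
  · rintro ⟨h1, h2⟩
    exact ⟨fun l => (h1 l).1, fun l => (lt_or_ge j l).elim (h2 l) (h1 l).2.1,
      fun l => (h1 l).2.2⟩
  · rintro ⟨h1, h2, h3⟩
    exact ⟨fun l => ⟨h1 l, fun _ => h2 l, h3 l⟩, fun l _ => h2 l⟩

/-- The constant is 576 = 6·96, from the information bounds and the one-coordinate bound. -/
theorem le_switchedInfoCost (P : Protocol k (Fin n → Bool)) {g : ℝ} (hg0 : 0 ≤ g)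
    (hg : ∀ j z, g ≤ sqHellinger ((recordFamily (glue j) P).full fun _ => true)
      ((recordFamily (glue j) P).full (eBar z))) :
    g / 576 * (n * k) ≤ P.switchedInfoCost (eta n k) := by
  have hlog : 0 < Real.log 2 := Real.log_pos one_lt_two
  have hlog1 : Real.log 2 ≤ 1 := by linarith [Real.log_two_lt_d9]
  have hB : ∀ i, ∀ ω ω' : Outcome n P,
      P.view i ω.1.1 ω.2 = P.view i ω'.1.1 ω'.2 ↔ viewVar P i ω = viewVar P i ω' :=
    fun i ω ω' => ⟨fun h => Subtype.ext h, fun h => congrArg Subtype.val h⟩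
  have h1 : P.switchedInfoCost (eta n k) = (∑ i,
      (cmi (outcomeLaw P) (fun ω => ω.1.1 i) (viewVar P i) (fun ω => (ω.1.2.1, ω.1.2.2)) +
        cmi (outcomeLaw P) (fun ω => ω.1.2.1) (viewVar P i) (fun ω => (ω.1.1 i, ω.1.2.2)))) /
      Real.log 2 := by
    rw [Protocol.switchedInfoCost, Finset.sum_div]
    refine Finset.sum_congr rfl fun i _ => ?_
    rw [condMutualInfo_eq, condMutualInfo_eq, ← add_div,
      cmi_congr _ (fun _ _ => Iff.rfl) (hB i) (fun _ _ => Iff.rfl),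
      cmi_congr _ (fun _ _ => Iff.rfl) (hB i) (fun _ _ => Iff.rfl)]
  have h2 : ∑ j : Fin n, ∑ i : Fin k,
      (1 / 6 * sqHellinger ((recordFamily (glue j) P).mixed i false)
        ((recordFamily (glue j) P).mixed i true) +
      1 / 6 * (1 / k * ∑ z ∈ Finset.univ.erase i,
        sqHellinger ((recordFamily (glue j) P).mixed i true)
        ((recordFamily (glue j) P).viewLaw i (eBar z)))) ≤ ∑ i,
      (cmi (outcomeLaw P) (fun ω => ω.1.1 i) (viewVar P i) (fun ω => (ω.1.2.1, ω.1.2.2)) +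
        cmi (outcomeLaw P) (fun ω => ω.1.2.1) (viewVar P i) (fun ω => (ω.1.1 i, ω.1.2.2))) := by
    rw [Finset.sum_comm]
    refine Finset.sum_le_sum fun i _ => ?_
    rw [Finset.sum_add_distrib]
    refine add_le_add ((Finset.sum_le_sum fun j _ => ?_).trans (sum_cmi_input_le P i))
      ((Finset.sum_le_sum fun j _ => ?_).trans (sum_cmi_aux_le P i))
    · exact sqHellinger_mixed_le_cmi P i j
    · exact sqHellinger_eBar_le_cmi P i j
  have h3 : ∑ j : Fin n, 1 / 6 * (k * g / 96) ≤ ∑ j : Fin n, ∑ i : Fin k,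
      (1 / 6 * sqHellinger ((recordFamily (glue j) P).mixed i false)
        ((recordFamily (glue j) P).mixed i true) +
      1 / 6 * (1 / k * ∑ z ∈ Finset.univ.erase i,
        sqHellinger ((recordFamily (glue j) P).mixed i true)
        ((recordFamily (glue j) P).viewLaw i (eBar z)))) := by
    refine Finset.sum_le_sum fun j _ => ?_
    refine (mul_le_mul_of_nonneg_left
      ((recordFamily (glue j) P).le_sum_sqHellinger (hg j)) (by norm_num)).trans_eq ?_
    rw [Finset.sum_add_distrib, ← Finset.mul_sum, ← Finset.mul_sum, ← Finset.mul_sum, mul_add]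
  have h4 := h3.trans h2
  rw [h1, le_div_iff₀ hlog]
  refine le_trans ?_ h4
  simp only [Finset.sum_const, Finset.card_univ, Fintype.card_fin, nsmul_eq_mul]
  have h5 : 0 ≤ g / 576 * (n * k) := by positivity
  -- Passing from nats to bits divides by log 2 ≤ 1, which only helps.
  nlinarith

end DirectSum

section Correctness

variable {n k : ℕ} [NeZero k]

/-! ### Correctness on the embedded inputs -/

/-- The answer when the bits of the coordinate `j` are `x`. -/
def answerAt (P : Protocol k (Fin n → Bool)) (j : Fin n) (x : Fin k → Bool)
    (ω : Rest {l // l < j} {l // j < l} P) : Bool :=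
  P.answer (embed (glue j) P x ω) ω.2.2

theorem sum_dist {Ω : Type*} [Fintype Ω] (μ : Dist Ω) : ∑ ω, μ ω = 1 := μ.2.2

theorem prob_univ {Ω : Type*} [Fintype Ω] (μ : Dist Ω) : prob μ Set.univ = 1 := by
  simp only [prob, Set.indicator_univ]
  exact sum_dist μ

theorem prob_le_one {Ω : Type*} [Fintype Ω] (μ : Dist Ω) (E : Set Ω) : prob μ E ≤ 1 :=
  (prob_mono μ (Set.subset_univ E)).trans_eq (prob_univ μ)

theorem prob_add_prob_not {Ω : Type*} [Fintype Ω] (μ : Dist Ω) (p : Ω → Prop) :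
    prob μ {ω | p ω} + prob μ {ω | ¬p ω} = 1 := by
  classical
  rw [prob_setOf, prob_setOf, ← Finset.sum_add_distrib, ← sum_dist μ]
  refine Finset.sum_congr rfl fun ω _ => ?_
  by_cases h : p ω <;> simp [h]

theorem prob_prod {Ω Ω' : Type*} [Fintype Ω] [Fintype Ω'] (μ : Dist Ω) (ν : Dist Ω')
    (p : Ω × Ω' → Prop) :
    prob (Dist.prod μ ν) {ω | p ω} = ∑ a, μ a * prob ν {b | p (a, b)} := by
  classical
  simp_rw [prob_setOf, Fintype.sum_prod_type, Finset.mul_sum, mul_ite, mul_zero]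
  rfl

theorem prob_pi {ι Ω : Type*} [Fintype ι] [DecidableEq ι] [Fintype Ω] (μ : ι → Dist Ω)
    (E : ι → Set Ω) : prob (Dist.pi μ) {t | ∀ i, t i ∈ E i} = ∏ i, prob (μ i) (E i) := by
  classical
  simp_rw [prob, Set.indicator_apply]
  rw [Finset.prod_univ_sum, Fintype.piFinset_univ]
  simp_rw [Finset.prod_ite_zero]
  simp only [Finset.mem_univ, forall_true_left, Set.mem_ofPred_eq]
  rfl

/-- Bound the conditional probability by ε on E and by 1 off E. -/
theorem prob_prod_le {Ω Ω' : Type*} [Fintype Ω] [Fintype Ω'] (μ : Dist Ω) (ν : Dist Ω')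
    (p : Ω × Ω' → Prop) (E : Set Ω) {ε : ℝ} (hε : 0 ≤ ε)
    (h : ∀ a ∈ E, prob ν {b | p (a, b)} ≤ ε) :
    prob (Dist.prod μ ν) {ω | p ω} ≤ ε + (1 - prob μ E) := by
  classical
  have h1 : prob μ E + prob μ {a | a ∉ E} = 1 := prob_add_prob_not μ (· ∈ E)
  rw [prob_prod, ← eq_sub_iff_add_eq'.mpr h1, prob_setOf, ← one_mul ε, ← sum_dist μ,
    Finset.sum_mul, ← Finset.sum_add_distrib]
  refine Finset.sum_le_sum fun a _ => ?_
  have ha : 0 ≤ μ a := μ.2.1 a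
  split_ifs with hE
  rotate_left
  · exact (mul_le_of_le_one_right ha (prob_le_one _ _)).trans (by nlinarith)
  · rw [add_zero]
    exact mul_le_mul_of_nonneg_left (h a hE) ha

/-- All-ones can occur only under M = 0, since `eBar z` contains a zero. -/
theorem prob_xi_not_ones : 1 - (1 / 2) ^ k ≤ prob (xi k) {s | ¬∀ i, s.1 i = true} := by
  classical
  have h := prob_add_prob_not (xi k) fun s => ∀ i, s.1 i = true
  have hk : (k : ℝ) ≠ 0 := Nat.cast_ne_zero.mpr (NeZero.ne k)
  have h1 : prob (xi k) {s | ∀ i, s.1 i = true} = 2 / 3 * (1 / 2) ^ k := by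
    rw [prob_setOf, Fintype.sum_prod_type, Finset.sum_eq_single (fun _ => true)]
    · have hz : ∀ z : Fin k, (fun _ : Fin k => true) ≠ eBar z := fun z h => by
        simpa [eBar] using congrFun h z
      simp [xi_apply, xiMass, Fintype.sum_prod_type, hz]
      field_simp
    · intro x _ hx
      have : ¬∀ i, x i = true := fun h => hx (funext h)
      simp [this]
    · simp
  have h2 : (0 : ℝ) ≤ (1 / 2) ^ k := by positivity
  linarith

theorem one_sub_le_prob_pi {L : Type*} [Fintype L] [DecidableEq L] :
    (1 - (1 / 2) ^ k) ^ Fintype.card L ≤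
      prob (Dist.pi fun _ : L => xi k) {t | ∀ l, t l ∈ {s : Sample k | ¬∀ i, s.1 i = true}} := by
  rw [prob_pi]
  refine le_trans (le_of_eq ?_) (Finset.prod_le_prod (fun _ _ => ?_) fun _ _ => prob_xi_not_ones)
  · rw [Finset.prod_const, Finset.card_univ]
  · exact sub_nonneg.mpr (pow_le_one₀ (by norm_num) (by norm_num))

omit [NeZero k] in
theorem disj_glue (j : Fin n) (x : Fin k → Bool) (lo : {l // l < j} → Sample k)
    (up : {l // j < l} → Sample k) :
    disj n k (fun i => glue j (fun l => (lo l).1 i) (x i) fun l => (up l).1 i) = false ↔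
      (∀ l, ¬∀ i, (lo l).1 i = true) ∧ (¬∀ i, x i = true) ∧ ∀ l, ¬∀ i, (up l).1 i = true := by
  rw [disj, decide_eq_false_iff_not, not_exists]
  rw [← forall_glue (fun v : Fin k → Bool => ¬∀ i, v i = true) j (fun l => (lo l).1) x
    (fun l => (up l).1)]
  refine forall_congr' fun l => not_congr (forall_congr' fun i => ?_)
  rw [apply_glue (fun v : Fin k → Bool => v i)]

theorem prob_answerAt_ones {P : Protocol k (Fin n → Bool)} {δ : ℝ}
    (hP : P.HasError (disj n k) δ) (hδ : 0 ≤ δ) (j : Fin n) :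
    prob (restLaw _ _ P) {ω | ¬answerAt P j (fun _ => true) ω = true} ≤ δ := by
  refine (prob_prod_le _ _ _ Set.univ hδ fun lo _ => ?_).trans_eq (by rw [prob_univ]; ring)
  refine (prob_prod_le _ _ _ Set.univ hδ fun up _ => ?_).trans_eq (by rw [prob_univ]; ring)
  have hX : disj n k (fun i => glue j (fun l => (lo l).1 i) true fun l => (up l).1 i) = true := by
    by_contra h
    exact ((disj_glue j (fun _ => true) lo up).mp (Bool.eq_false_of_not_eq_true h)).2.1
      fun _ => rfl
  have h := hP fun i => glue j (fun l => (lo l).1 i) true fun l => (up l).1 i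
  rw [hX] at h
  exact h

theorem prob_answerAt_eBar {P : Protocol k (Fin n → Bool)} {δ : ℝ}
    (hP : P.HasError (disj n k) δ) (hδ : 0 ≤ δ) (j : Fin n) (z : Fin k) :
    prob (restLaw _ _ P) {ω | answerAt P j (eBar z) ω = true} ≤
      δ + (n - 1) * (1 / 2) ^ k := by
  have hcard : ((Fintype.card {l // l < j} : ℝ) + Fintype.card {l // j < l}) = n - 1 := by
    rw [Fintype.card_of_subtype (Finset.Iio j) (by simp),
      Fintype.card_of_subtype (Finset.Ioi j) (by simp), Fin.card_Iio, Fin.card_Ioi]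
    have := j.2
    rw [Nat.cast_sub (by omega), Nat.cast_sub (by omega)]
    push_cast
    ring
  -- Bernoulli's inequality, in place of a union bound over the other coordinates.
  have hb : ∀ m : ℕ, 1 - m * (1 / 2 : ℝ) ^ k ≤ (1 - (1 / 2) ^ k) ^ m := fun m => by
    have h1 : (1 / 2 : ℝ) ^ k ≤ 1 := pow_le_one₀ (by norm_num) (by norm_num)
    have h := one_add_mul_le_pow (a := -(1 / 2 : ℝ) ^ k) (by linarith) m
    rw [← sub_eq_add_neg] at h
    linarith
  have hL := (hb _).trans (one_sub_le_prob_pi (k := k) (L := {l // l < j}))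
  have hU := (hb _).trans (one_sub_le_prob_pi (k := k) (L := {l // j < l}))
  have hU1 := prob_le_one (Dist.pi fun _ : {l // j < l} => xi k)
    {t | ∀ l, t l ∈ {s : Sample k | ¬∀ i, s.1 i = true}}
  have key := prob_prod_le (Dist.pi fun _ : {l // l < j} => xi k)
    (Dist.prod (Dist.pi fun _ : {l // j < l} => xi k) P.coinLaw)
    (fun ω => answerAt P j (eBar z) ω = true)
    {t | ∀ l, t l ∈ {s : Sample k | ¬∀ i, s.1 i = true}}
    (add_nonneg hδ (sub_nonneg.mpr hU1)) fun lo hlo => by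
      refine prob_prod_le _ _ _ _ hδ fun up hup => ?_
      have hX : disj n k (fun i => glue j (fun l => (lo l).1 i) (eBar z i)
          fun l => (up l).1 i) = false :=
        (disj_glue j (eBar z) lo up).mpr ⟨hlo, fun h => by simpa [eBar] using h z, hup⟩
      have h := hP fun i => glue j (fun l => (lo l).1 i) (eBar z i) fun l => (up l).1 i
      simp only [hX, ne_eq, Bool.not_eq_false] at h
      exact h
  refine key.trans ?_
  rw [← hcard]
  linarith

theorem sum_full_eq_prob (P : Protocol k (Fin n → Bool)) (j : Fin n) (x : Fin k → Bool) :
    ∑ t ∈ Finset.univ.filter fun t : Record {l // l < j} {l // j < l} P =>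
      P.output t.2.2.1 t.2.2.2.1 = true, (recordFamily (glue j) P).full x t =
    prob (restLaw _ _ P) {ω | answerAt P j x ω = true} := by
  classical
  have h := sum_mul_comp (restLaw _ _ P) (record (glue j) P x)
    fun t => if P.output t.2.2.1 t.2.2.2.1 = true then 1 else 0
  simp only [mul_ite, mul_one, mul_zero] at h
  rw [Finset.sum_filter, recordFamily_full, ← h, prob_setOf]
  refine Finset.sum_congr rfl fun ω _ => ?_
  change (if answerAt P j x ω = true then _ else _) = _
  congr

/-- The record contains the coordinator's coins and transcript, so it determines the answer; the
acceptance gap therefore bounds the distance of the records from below. -/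
theorem le_sqHellinger_of_hasError {P : Protocol k (Fin n → Bool)} {δ : ℝ}
    (hP : P.HasError (disj n k) δ) (hδ : 0 ≤ δ) {g : ℝ} (hg0 : 0 ≤ g)
    (hg : g ≤ 1 - 2 * δ - (n - 1) * (1 / 2) ^ k) (j : Fin n) (z : Fin k) :
    g ^ 2 / 4 ≤ sqHellinger ((recordFamily (glue j) P).full fun _ => true)
      ((recordFamily (glue j) P).full (eBar z)) := by
  have h1 := prob_answerAt_ones hP hδ j
  have h2 := prob_answerAt_eBar hP hδ j z
  have h3 := prob_add_prob_not (restLaw _ _ P) fun ω => answerAt P j (fun _ => true) ω = true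
  have h4 := sq_sum_sub_le_sqHellinger ((recordFamily (glue j) P).full_nonneg fun _ => true)
    ((recordFamily (glue j) P).full_nonneg (eBar z)) ((recordFamily (glue j) P).sum_eq_one _)
    ((recordFamily (glue j) P).sum_eq_one _) (Finset.univ.filter fun t =>
      P.output t.2.2.1 t.2.2.2.1 = true)
  rw [sum_full_eq_prob, sum_full_eq_prob] at h4
  have h5 : g ≤ prob (restLaw _ _ P) {ω | answerAt P j (fun _ => true) ω = true} -
      prob (restLaw _ _ P) {ω | answerAt P j (eBar z) ω = true} := by linarith
  have h6 := pow_le_pow_left₀ hg0 h5 2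
  linarith

theorem mul_half_pow_le {δ : ℝ} (hδ₀ : 0 ≤ δ) (hδ : δ < 1 / 2) {n k : ℕ} (hn : 1 ≤ n)
    (hk : (1 + Real.logb 2 (2 / (1 - 2 * δ))) * Real.logb 2 n ≤ k) :
    ((n : ℝ) - 1) * (1 / 2) ^ k ≤ (1 - 2 * δ) / 2 := by
  -- For n = 1 the logarithm vanishes and k is unconstrained, but so does the factor n - 1.
  obtain rfl | hn2 : n = 1 ∨ 2 ≤ n := by omega
  · simp only [Nat.cast_one, sub_self, zero_mul]
    linarith
  · have hn' : (2 : ℝ) ≤ n := by exact_mod_cast hn2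
    have hd : 0 < 1 - 2 * δ := by linarith
    have h1 : 1 ≤ Real.logb 2 n := by
      rw [Real.le_logb_iff_rpow_le one_lt_two (by linarith)]
      simpa using hn'
    have h2 : 0 ≤ Real.logb 2 (2 / (1 - 2 * δ)) :=
      Real.logb_nonneg one_lt_two (by rw [le_div_iff₀ hd]; linarith)
    -- As log₂ n ≥ 1, the constant term log₂(2/(1-2δ)) is at most its multiple by log₂ n.
    have h3 : Real.logb 2 (n * (2 / (1 - 2 * δ))) ≤ k := by
      rw [Real.logb_mul (by linarith) (by positivity)]
      nlinarith
    rw [Real.logb_le_iff_le_rpow one_lt_two (by positivity), Real.rpow_natCast] at h3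
    have h4 : (0 : ℝ) < 2 ^ k := by positivity
    rw [one_div, inv_pow, ← div_eq_mul_inv, div_le_iff₀ h4]
    calc (n : ℝ) - 1 ≤ n := by linarith
      _ = (1 - 2 * δ) / 2 * (n * (2 / (1 - 2 * δ))) := by field_simp
      _ ≤ _ := mul_le_mul_of_nonneg_left h3 (by linarith)

end Correctness

end

end SetDisjointness

theorem mainTheorem4 (δ : ℝ) (hδ₀ : 0 ≤ δ) (hδ : δ < 1 / 2) :
    ∃ C : ℝ, 0 < C ∧ ∃ c : ℝ, 0 < c ∧
      ∀ (n k : ℕ) [NeZero k], 1 ≤ n → C * Real.logb 2 n ≤ k →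
        ((c * (n * k) : ℝ) : EReal) ≤
          SetDisjointness.switchedInfoComplexity (SetDisjointness.eta n k) δ
            (SetDisjointness.disj n k) := by
  have hd : 0 < 1 - 2 * δ := by linarith
  -- This C makes (n-1)2^(-k) at most (1-2δ)/2, leaving an acceptance gap of (1-2δ)/2. Its square
  -- over 4 bounds h², and 576 is the loss in the direct sum.
  refine ⟨1 + Real.logb 2 (2 / (1 - 2 * δ)), add_pos_of_pos_of_nonneg one_pos
    (Real.logb_nonneg one_lt_two (by rw [le_div_iff₀ hd]; linarith)),
    ((1 - 2 * δ) / 2) ^ 2 / 4 / 576, by positivity, fun n k _ hn hk => ?_⟩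
  refine le_iInf₂ fun P hP => EReal.coe_le_coe_iff.mpr ?_
  refine SetDisjointness.le_switchedInfoCost P (by positivity) fun j z =>
    SetDisjointness.le_sqHellinger_of_hasError hP hδ₀ (by linarith) ?_ j z
  have := SetDisjointness.mul_half_pow_le hδ₀ hδ hn hk
  linarith
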